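/- Let $n,m\ge 0$ and let $\alpha_1,\dots,\alpha_m\in\mathbb C[x]=\mathbb C[x_1,\dots,x_n]$ be polynomials of degree one such that the hyperplanes $H_i=V(\alpha_i)\subset\mathbb C^n$ are in general position: for every $S\subseteq\{1,\dots,m\}$, the intersection $\bigcap_{i\in S}H_i$ (which is $\mathbb C^n$ for $S=\emptyset$) is a nonempty affine subspace of dimension $n-|S|$ if $|S|\le n$, and is empty if $|S|>n$. Let $\beta=(\beta_1,\dots,\beta_m)\in\mathbb C^m$ and $\alpha=\alpha_1\cdots\alpha_m$. Let $M_\alpha^\beta=\mathbb C[x]_\alpha\,\alpha^\beta$ be the free $\mathbb C[x]_\alpha$-module of rank one on the generator $\alpha^\beta=\alpha_1^{\beta_1}\cdots\alpha_m^{\beta_m}$, regarded as a left module over the $n$-th Weyl algebra $A_n=\mathbb C\langle x_1,\dots,x_n,\partial_1,\dots,\partial_n\rangle$ in which $x_j$ acts by multiplication and $$\partial_j(f\alpha^\beta)=\Bigl(\partial_j f+f\sum_{i=1}^m\beta_i\frac{\partial_j(\alpha_i)}{\alpha_i}\Bigr)\alpha^\beta\qquad(f\in\mathbb C[x]_\alpha,\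 1\le j\le n).$$ Let $0\le k\le m$, and assume that $\beta_1,\dots,\beta_k\in\mathbb Z$ and $\beta_{k+1},\dots,\beta_m\in\mathbb C\setminus\mathbb Z$. Then $M_\alpha^\beta$ has finite length as an $A_n$-module, and the number $c(M_\alpha^\beta)$ of its decomposition factors (the length of a composition series) is $$c(M_\alpha^\beta)=\sum_{j=0}^{n}\binom{k}{j},$$ where $\binom{k}{j}=0$ if $j>k$. -/

import Mathlib

open MvPolynomial

noncomputable section

/-! ### The Weyl algebra -/

/-- The defining relations of the `n`-th Weyl algebra on the free generators
`Sum.inl i` (the coordinate `x i`) and `Sum.inr i` (the partial derivative `∂ i`). -/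
inductive WeylRel (n : ℕ) :
    FreeAlgebra ℂ (Fin n ⊕ Fin n) → FreeAlgebra ℂ (Fin n ⊕ Fin n) → Prop
  | x_comm (i j : Fin n) :
      WeylRel n (FreeAlgebra.ι ℂ (Sum.inl i) * FreeAlgebra.ι ℂ (Sum.inl j))
        (FreeAlgebra.ι ℂ (Sum.inl j) * FreeAlgebra.ι ℂ (Sum.inl i))
  | d_comm (i j : Fin n) :
      WeylRel n (FreeAlgebra.ι ℂ (Sum.inr i) * FreeAlgebra.ι ℂ (Sum.inr j))
        (FreeAlgebra.ι ℂ (Sum.inr j) * FreeAlgebra.ι ℂ (Sum.inr i))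
  | d_x (i j : Fin n) :
      WeylRel n (FreeAlgebra.ι ℂ (Sum.inr i) * FreeAlgebra.ι ℂ (Sum.inl j))
        (FreeAlgebra.ι ℂ (Sum.inl j) * FreeAlgebra.ι ℂ (Sum.inr i) + if i = j then 1 else 0)

/-- The `n`-th Weyl algebra `A_n = ℂ⟨x_1, …, x_n, ∂_1, …, ∂_n⟩` over `ℂ`. -/
abbrev WeylAlgebra (n : ℕ) : Type := RingQuot (WeylRel n)

namespace WeylAlgebra

/-- The generator `x_i` of the Weyl algebra. -/
def x {n : ℕ} (i : Fin n) : WeylAlgebra n :=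
  RingQuot.mkAlgHom ℂ (WeylRel n) (FreeAlgebra.ι ℂ (Sum.inl i))

/-- The generator `∂_i` of the Weyl algebra. -/
def d {n : ℕ} (i : Fin n) : WeylAlgebra n :=
  RingQuot.mkAlgHom ℂ (WeylRel n) (FreeAlgebra.ι ℂ (Sum.inr i))

end WeylAlgebra

/-! ### Extending a derivation to a localization -/

section LocalizedDerivation

variable {R : Type*} [CommRing R] [Algebra ℂ R] (S : Submonoid R)

/-- For a derivation `D` of `R`, the ring homomorphism `r ↦ r + ε D(r)` from the localization of `R`
to the dual numbers over it. -/
def localizedDualHom (D : Derivation ℂ R R) :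
    Localization S →+* TrivSqZeroExt (Localization S) (Localization S) :=
  IsLocalization.lift (M := S)
    (g := { toFun := fun r => TrivSqZeroExt.inl (algebraMap R (Localization S) r)
              + TrivSqZeroExt.inr (algebraMap R (Localization S) (D r))
            map_one' := by ext <;> simp
            map_zero' := by ext <;> simp
            map_mul' := fun a b => by
              ext
              · simp
              · simp only [TrivSqZeroExt.snd_add, TrivSqZeroExt.snd_inl, TrivSqZeroExt.snd_inr,
                  TrivSqZeroExt.snd_mul, TrivSqZeroExt.fst_add, TrivSqZeroExt.fst_inl,
                  TrivSqZeroExt.fst_inr, Derivation.leibniz, smul_eq_mul, map_add, map_mul,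
                  MulOpposite.smul_eq_mul_unop, MulOpposite.unop_op]
                ring
            map_add' := fun a b => by ext <;> simp [Algebra.smul_def] })
    (fun y => by
      rw [TrivSqZeroExt.isUnit_iff_isUnit_fst]
      simpa using IsLocalization.map_units (Localization S) y)

lemma localizedDualHom_algebraMap (D : Derivation ℂ R R) (r : R) :
    localizedDualHom S D (algebraMap R (Localization S) r)
      = TrivSqZeroExt.inl (algebraMap R (Localization S) r)
        + TrivSqZeroExt.inr (algebraMap R (Localization S) (D r)) := by
  unfold localizedDualHom
  rw [IsLocalization.lift_eq]
  rfl

lemma fst_localizedDualHom (D : Derivation ℂ R R) (f : Localization S) :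
    (localizedDualHom S D f).fst = f := by
  have h : ((TrivSqZeroExt.fstHom ℂ (Localization S) (Localization S)).toRingHom.comp
      (localizedDualHom S D)) = RingHom.id _ := by
    apply IsLocalization.ringHom_ext S
    ext r
    simp [localizedDualHom_algebraMap]
  exact congrArg (fun g => g f) h

/-- The unique extension of a derivation `D` of `R` to a derivation of a localization of `R`. -/
def localizedDerivation (D : Derivation ℂ R R) :
    Derivation ℂ (Localization S) (Localization S) :=
  Derivation.mk'
    { toFun := fun f => (localizedDualHom S D f).snd
      map_add' := fun f g => by simp
      map_smul' := fun c f => by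
        have hc : localizedDualHom S D (algebraMap ℂ (Localization S) c)
            = TrivSqZeroExt.inl (algebraMap ℂ (Localization S) c) := by
          rw [IsScalarTower.algebraMap_apply ℂ R (Localization S), localizedDualHom_algebraMap]
          simp
        rw [Algebra.smul_def, map_mul, hc]
        simp [Algebra.smul_def] }
    (fun f g => by
      simp [fst_localizedDualHom, mul_comm])

/-- The extended derivation restricts to the given one. -/
lemma localizedDerivation_algebraMap (D : Derivation ℂ R R) (r : R) :
    localizedDerivation S D (algebraMap R (Localization S) r)
      = algebraMap R (Localization S) (D r) := by
  change (localizedDualHom S D (algebraMap R (Localization S) r)).snd = _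
  rw [localizedDualHom_algebraMap, TrivSqZeroExt.snd_add, TrivSqZeroExt.snd_inl,
    TrivSqZeroExt.snd_inr, zero_add]

/-- Two derivations of a localization that agree on the base ring are equal. -/
lemma derivation_localization_ext {D E : Derivation ℂ (Localization S) (Localization S)}
    (h : ∀ r : R, D (algebraMap R (Localization S) r) = E (algebraMap R (Localization S) r)) :
    D = E := by
  ext f
  obtain ⟨⟨r, s⟩, hs⟩ := IsLocalization.surj S f
  have hD := congrArg D hs
  have hE := congrArg E hs
  simp only [Derivation.leibniz, smul_eq_mul] at hD hE
  rw [h, h, ← hE] at hD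
  exact (IsLocalization.map_units (Localization S) s).mul_left_cancel (by linear_combination hD)

end LocalizedDerivation

/-! ### The twisted module `ℂ[x]_α α^β` -/

section TwistedModule

variable {n m : ℕ} (α : Fin m → MvPolynomial (Fin n) ℂ) (β : Fin m → ℂ)

/-- The localization `ℂ[x]_α` of `ℂ[x_1, …, x_n]` at `α = α_1 ⋯ α_m`. -/
abbrev LocRing : Type := Localization (Submonoid.powers (∏ i, α i))

/-- The derivation `∂/∂x_j` of `ℂ[x]_α`. -/
def locPDeriv (j : Fin n) : Derivation ℂ (LocRing α) (LocRing α) :=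
  localizedDerivation (Submonoid.powers (∏ i, α i)) (pderiv j)

lemma locPDeriv_algebraMap (j : Fin n) (p : MvPolynomial (Fin n) ℂ) :
    locPDeriv α j (algebraMap _ (LocRing α) p) = algebraMap _ (LocRing α) (pderiv j p) :=
  localizedDerivation_algebraMap _ _ _

lemma isUnit_algebraMap_factor (i : Fin m) :
    IsUnit (algebraMap (MvPolynomial (Fin n) ℂ) (LocRing α) (α i)) := by
  have h := IsLocalization.map_units (LocRing α)
    (⟨∏ i, α i, Submonoid.mem_powers _⟩ : Submonoid.powers (∏ i, α i))
  exact isUnit_of_dvd_unit (map_dvd _ (Finset.dvd_prod_of_mem α (Finset.mem_univ i))) h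

/-- `α_i` as an invertible element of `ℂ[x]_α`. -/
def factorUnit (i : Fin m) : (LocRing α)ˣ := (isUnit_algebraMap_factor α i).unit

/-- The logarithmic derivative `∑ i, β_i ∂_j(α_i) / α_i` in `ℂ[x]_α`. -/
def logDerivCoeff (j : Fin n) : LocRing α :=
  ∑ i, β i • (algebraMap (MvPolynomial (Fin n) ℂ) (LocRing α) (pderiv j (α i))
    * ((factorUnit α i)⁻¹ : (LocRing α)ˣ))

/-- The free `ℂ[x]_α`-module of rank one `M_α^β = ℂ[x]_α α^β`. The element `f` of the underlying
type stands for `f • α^β`. -/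
@[nolint unusedArguments]
def TwistedModule {n m : ℕ} (α : Fin m → MvPolynomial (Fin n) ℂ) (_β : Fin m → ℂ) : Type :=
  LocRing α

instance : AddCommGroup (TwistedModule α β) := inferInstanceAs (AddCommGroup (LocRing α))

instance : Module (LocRing α) (TwistedModule α β) := inferInstanceAs (Module (LocRing α) (LocRing α))

instance : Module ℂ (TwistedModule α β) := inferInstanceAs (Module ℂ (LocRing α))

/-- The generator `α^β` of `M_α^β`. -/
def twistedGen : TwistedModule α β := (1 : LocRing α)

/-- `f ↦ f • α^β`, which identifies `ℂ[x]_α` with `M_α^β`. -/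
def toTwisted : LocRing α ≃ₗ[LocRing α] TwistedModule α β := LinearEquiv.refl _ _

lemma toTwisted_apply (f : LocRing α) : toTwisted α β f = f • twistedGen α β :=
  (mul_one f).symm

/-- Multiplication by `x_i`. -/
def twistedX (i : Fin n) : Module.End ℂ (LocRing α) :=
  LinearMap.mulLeft ℂ (algebraMap (MvPolynomial (Fin n) ℂ) (LocRing α) (X i))

/-- The operator `f ↦ ∂_j f + f * ∑ i, β_i ∂_j(α_i) / α_i`, by which `∂_j` acts on the coefficient
`f` of `f • α^β`. -/
def twistedD (j : Fin n) : Module.End ℂ (LocRing α) :=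
  (locPDeriv α j : LocRing α →ₗ[ℂ] LocRing α) + LinearMap.mulLeft ℂ (logDerivCoeff α β j)

lemma locPDeriv_comm (i j : Fin n) (f : LocRing α) :
    locPDeriv α i (locPDeriv α j f) = locPDeriv α j (locPDeriv α i f) := by
  have hp : ∀ p : MvPolynomial (Fin n) ℂ, pderiv i (pderiv j p) = pderiv j (pderiv i p) := by
    have : ⁅(pderiv i : Derivation ℂ (MvPolynomial (Fin n) ℂ) (MvPolynomial (Fin n) ℂ)),
        (pderiv j : Derivation ℂ (MvPolynomial (Fin n) ℂ) (MvPolynomial (Fin n) ℂ))⁆ = 0 := by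
      apply MvPolynomial.derivation_ext
      intro k
      classical
      simp [Derivation.commutator_apply, pderiv_X, Pi.single_apply, apply_ite]
    intro p
    have h := congrArg (fun D => D p) this
    simpa [Derivation.commutator_apply, sub_eq_zero] using h
  have : ⁅locPDeriv α i, locPDeriv α j⁆ = 0 := by
    apply derivation_localization_ext
    intro p
    simp [Derivation.commutator_apply, locPDeriv_algebraMap, hp]
  have h := congrArg (fun D => D f) this
  simpa [Derivation.commutator_apply, sub_eq_zero] using h

lemma derivation_log_comm {A : Type*} [CommRing A] [Algebra ℂ A] (D E : Derivation ℂ A A)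
    {a u : A} (hc : D (E a) = E (D a)) (hu : u * a = 1) :
    D (E a * u) = E (D a * u) := by
  rw [D.leibniz, E.leibniz, D.leibniz_of_mul_eq_one hu, E.leibniz_of_mul_eq_one hu, hc]
  simp only [smul_eq_mul]
  ring

lemma locPDeriv_logDerivCoeff (i j : Fin n) :
    locPDeriv α i (logDerivCoeff α β j) = locPDeriv α j (logDerivCoeff α β i) := by
  unfold logDerivCoeff
  rw [map_sum, map_sum]
  refine Finset.sum_congr rfl fun l _ => ?_
  rw [Derivation.map_smul, Derivation.map_smul, ← locPDeriv_algebraMap, ← locPDeriv_algebraMap]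
  exact congrArg (β l • ·) (derivation_log_comm (locPDeriv α i) (locPDeriv α j)
    (locPDeriv_comm α i j _) (factorUnit α l).inv_mul)

/-- The `A_n`-action on `M_α^β`, written on the coefficient `f` of `f • α^β`. -/
def twistedRep : WeylAlgebra n →ₐ[ℂ] Module.End ℂ (LocRing α) :=
  RingQuot.liftAlgHom ℂ ⟨FreeAlgebra.lift ℂ (Sum.elim (twistedX α) (twistedD α β)), by
    intro a b h
    induction h with
    | x_comm i j =>
      simp only [map_mul, FreeAlgebra.lift_ι_apply, Sum.elim_inl]
      refine LinearMap.ext fun (f : LocRing α) => ?_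
      exact mul_left_comm (algebraMap (MvPolynomial (Fin n) ℂ) (LocRing α) (X i))
        (algebraMap (MvPolynomial (Fin n) ℂ) (LocRing α) (X j)) f
    | d_comm i j =>
      simp only [map_mul, FreeAlgebra.lift_ι_apply, Sum.elim_inr]
      refine LinearMap.ext fun (f : LocRing α) => ?_
      change locPDeriv α i (locPDeriv α j f + logDerivCoeff α β j * f)
          + logDerivCoeff α β i * (locPDeriv α j f + logDerivCoeff α β j * f)
        = locPDeriv α j (locPDeriv α i f + logDerivCoeff α β i * f)
          + logDerivCoeff α β j * (locPDeriv α i f + logDerivCoeff α β i * f)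
      simp only [map_add, Derivation.leibniz, smul_eq_mul]
      rw [locPDeriv_comm α i j, locPDeriv_logDerivCoeff α β i j]
      ring
    | d_x i j =>
      simp only [map_mul, map_add, FreeAlgebra.lift_ι_apply, Sum.elim_inr, Sum.elim_inl]
      refine LinearMap.ext fun (f : LocRing α) => ?_
      have hx : locPDeriv α i (algebraMap (MvPolynomial (Fin n) ℂ) (LocRing α) (X j)) = if i = j then 1 else 0 := by
        classical
        rw [locPDeriv_algebraMap, pderiv_X, Pi.single_apply]
        simp only [eq_comm]
        split_ifs <;> simp
      have key : locPDeriv α i (algebraMap (MvPolynomial (Fin n) ℂ) (LocRing α) (X j) * f)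
          + logDerivCoeff α β i * (algebraMap (MvPolynomial (Fin n) ℂ) (LocRing α) (X j) * f)
        = algebraMap (MvPolynomial (Fin n) ℂ) (LocRing α) (X j) * (locPDeriv α i f + logDerivCoeff α β i * f)
          + (if i = j then 1 else 0) * f := by
        simp only [Derivation.leibniz, smul_eq_mul, hx]
        ring
      by_cases hij : i = j
      · simp only [hij, if_true, one_mul, map_one] at key ⊢
        exact key
      · simp only [hij, if_false, zero_mul, map_zero] at key ⊢
        exact key⟩

/-- `M_α^β` as a left module over the Weyl algebra. -/
instance : Module (WeylAlgebra n) (TwistedModule α β) :=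
  Module.compHom (LocRing α) (twistedRep α β).toRingHom

lemma weyl_x_smul (i : Fin n) (f : LocRing α) :
    WeylAlgebra.x i • toTwisted α β f
      = toTwisted α β (algebraMap (MvPolynomial (Fin n) ℂ) (LocRing α) (X i) * f) := by
  have h : twistedRep α β (WeylAlgebra.x i) = twistedX α i := by
    simp only [twistedRep, WeylAlgebra.x, RingQuot.liftAlgHom_mkAlgHom_apply,
      FreeAlgebra.lift_ι_apply, Sum.elim_inl]
  exact congrArg (fun T : Module.End ℂ (LocRing α) => T f) h

lemma weyl_d_smul (j : Fin n) (f : LocRing α) :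
    WeylAlgebra.d j • toTwisted α β f
      = toTwisted α β (locPDeriv α j f + logDerivCoeff α β j * f) := by
  have h : twistedRep α β (WeylAlgebra.d j) = twistedD α β j := by
    simp only [twistedRep, WeylAlgebra.d, RingQuot.liftAlgHom_mkAlgHom_apply,
      FreeAlgebra.lift_ι_apply, Sum.elim_inr]
  exact congrArg (fun T : Module.End ℂ (LocRing α) => T f) h

/-- `∂_j (α^β) = (∑ i, β_i ∂_j(α_i) / α_i) • α^β`. -/
lemma weyl_d_gen (j : Fin n) :
    (WeylAlgebra.d j : WeylAlgebra n) • twistedGen α β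
      = logDerivCoeff α β j • twistedGen α β := by
  have h := weyl_d_smul α β j 1
  rw [Derivation.map_one_eq_zero, zero_add, mul_one, toTwisted_apply, toTwisted_apply,
    one_smul] at h
  exact h

end TwistedModule

/-! ### Hyperplane configurations in general position -/

/-- The zero set `V(p)` in `ℂ^n`; an affine hyperplane when `p` has degree one. -/
def zeroSet {n : ℕ} (p : MvPolynomial (Fin n) ℂ) : Set (Fin n → ℂ) :=
  {v | eval v p = 0}

/-- The intersection of the hyperplanes `V(α_i)`, `i ∈ S` (all of `ℂ^n` if `S` is empty). -/
def flat {n m : ℕ} (α : Fin m → MvPolynomial (Fin n) ℂ) (S : Finset (Fin m)) :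
    Set (Fin n → ℂ) :=
  ⋂ i ∈ S, zeroSet (α i)

/-- The polynomials `α_1, …, α_m` of degree one define hyperplanes `V(α_1), …, V(α_m)` of `ℂ^n` in
general position: any `p ≤ n` of them meet in a (nonempty) affine subspace of dimension `n - p`, and
any `p > n` of them have empty intersection. -/
structure InGeneralPosition {n m : ℕ} (α : Fin m → MvPolynomial (Fin n) ℂ) : Prop where
  degree_one : ∀ i, (α i).totalDegree = 1
  nonempty_of_card_le : ∀ S : Finset (Fin m), S.card ≤ n → (flat α S).Nonempty
  dim_of_card_le : ∀ S : Finset (Fin m), S.card ≤ n →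
    Module.finrank ℂ (vectorSpan ℂ (flat α S)) + S.card = n
  empty_of_card_gt : ∀ S : Finset (Fin m), n < S.card → flat α S = ∅

end

/-! Let `I` be the set of indices with integral exponent. For `S ⊆ I`, `poleModule α I b S` consists
of the elements that, among the hyperplanes indexed by `I`, have poles only along those in `S`. It
is a submodule because differentiating a zeroth power yields the coefficient zero. If `S` has more
than `n` elements, the corresponding `α i` generate the unit ideal, so partial fractions make
`poleModule α I b S` the sum of the modules for smaller sets
(`InGeneralPosition.poleModule_le_iSup`). Hence the whole module is the sum over the sets `S ⊆ I`
with at most `n` elements. Adding these sets one at a time, subsets before supersets, gives a chain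
with one step per set, and the length is the number of such sets.

Each step must be a cover. It is strict because a monomial with simple poles exactly along `P` is
not a sum of elements each regular along some hyperplane of `P`
(`InGeneralPosition.mon_notMem_iSup`, by Taylor expansion normal to the flat of `P`).

It is minimal by `IsDStable.poleModule_le`. Modulo the modules for the sets `P.erase j`, the factors
`α j`, `j ∈ P`, act nilpotently, so a nonzero submodule of the quotient contains a nonzero element
killed by all of them. Euler operators turn this element into `g α^c` with simple poles along `P`
and `g` nonzero on the flat. Differentiating along the flat reduces `g` to a constant. From the
resulting monomial, normal derivatives produce all higher poles, and non-integrality of the other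
exponents yields the rest of `poleModule α I b P`. -/

noncomputable section

/-! ### The twisted directional derivatives and monomials in the `α i` -/

section Calculus

variable {n m : ℕ} (α : Fin m → MvPolynomial (Fin n) ℂ) (β : Fin m → ℂ)

/-- The directional derivative of polynomials along a constant vector. -/
def dirDeriv (v : Fin n → ℂ) : Derivation ℂ (MvPolynomial (Fin n) ℂ) (MvPolynomial (Fin n) ℂ) :=
  ∑ j, v j • pderiv j

/-- The derivative along `v` of the linear part of `α i`. -/
def linCoeff (i : Fin m) (v : Fin n → ℂ) : ℂ :=
  ∑ j, v j * coeff (Finsupp.single j 1) (α i)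

lemma dirDeriv_apply (v : Fin n → ℂ) (p : MvPolynomial (Fin n) ℂ) :
    dirDeriv v p = ∑ j, v j • pderiv j p := by
  rw [dirDeriv, ← Derivation.coeFnAddMonoidHom_apply, map_sum, Finset.sum_apply]
  rfl

lemma eq_linear_of_totalDegree_le_one {p : MvPolynomial (Fin n) ℂ} (hp : p.totalDegree ≤ 1) :
    p = C (coeff 0 p) + ∑ j, C (coeff (Finsupp.single j 1) p) * X j := by
  classical
  ext d
  simp only [coeff_add, coeff_C, coeff_sum, coeff_C_mul, coeff_X]
  by_cases hd : d = 0
  · subst hd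
    simp
  · by_cases h1 : ∃ j, d = Finsupp.single j 1
    · obtain ⟨j, rfl⟩ := h1
      simp [Finsupp.single_left_inj, Ne.symm hd]
    · have h0 : coeff d p = 0 := by
        by_contra hne
        have hle := le_totalDegree (mem_support_iff.mpr hne)
        have hs : (d.sum fun _ e => e) = 1 := by
          refine le_antisymm (hle.trans hp) (Nat.one_le_iff_ne_zero.mpr fun h => hd ?_)
          ext i
          by_contra hi
          rw [Finsupp.sum, Finset.sum_eq_zero_iff] at h
          exact hi (h i (Finsupp.mem_support_iff.mpr hi))
        obtain ⟨j, hj⟩ := (Finsupp.sum_eq_one_iff d).mp hs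
        exact h1 ⟨j, hj⟩
      rw [h0, if_neg (Ne.symm hd), zero_add, eq_comm]
      refine Finset.sum_eq_zero fun j _ => ?_
      rw [if_neg fun h => h1 ⟨j, h.symm⟩, mul_zero]

lemma pderiv_eq_C_of_totalDegree_le_one {p : MvPolynomial (Fin n) ℂ} (hp : p.totalDegree ≤ 1)
    (j : Fin n) : pderiv j p = C (coeff (Finsupp.single j 1) p) := by
  classical
  conv_lhs => rw [eq_linear_of_totalDegree_le_one hp]
  simp [pderiv_X, Pi.single_apply]

lemma dirDeriv_factor (hd : ∀ i, (α i).totalDegree ≤ 1) (i : Fin m) (v : Fin n → ℂ) :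
    dirDeriv v (α i) = C (linCoeff α i v) := by
  rw [dirDeriv_apply, linCoeff, map_sum]
  refine Finset.sum_congr rfl fun j _ => ?_
  rw [pderiv_eq_C_of_totalDegree_le_one (hd i), smul_eq_C_mul, map_mul]

/-- The monomial `∏ i, α_i ^ c_i` in `ℂ[x]_α`. -/
def mon (c : Fin m → ℤ) : LocRing α := ((∏ i, factorUnit α i ^ c i : (LocRing α)ˣ) : LocRing α)

lemma mon_zero : mon α 0 = 1 := by simp [mon]

lemma mon_add (c d : Fin m → ℤ) : mon α (c + d) = mon α c * mon α d := by
  simp [mon, zpow_add, Finset.prod_mul_distrib]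

lemma prod_zpow_single {G ι : Type*} [CommGroup G] [Fintype ι] [DecidableEq ι] (u : ι → G)
    (i : ι) (k : ℤ) : ∏ j, u j ^ (Pi.single i k : ι → ℤ) j = u i ^ k := by
  rw [Finset.prod_eq_single i (fun j _ hj => by simp [Pi.single_eq_of_ne hj]) (by simp)]
  simp

lemma mon_single (i : Fin m) : mon α (Pi.single i 1) = algebraMap _ (LocRing α) (α i) :=
  congrArg Units.val ((prod_zpow_single (factorUnit α) i 1).trans (zpow_one _))

lemma mon_neg_single (i : Fin m) :
    mon α (-Pi.single i 1) = ((factorUnit α i)⁻¹ : (LocRing α)ˣ) := by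
  rw [← Pi.single_neg]
  exact congrArg Units.val ((prod_zpow_single (factorUnit α) i (-1)).trans (zpow_neg_one _))

/-- The polynomial `∏ i, α_i ^ c_i`, with negative exponents read as zero. -/
def polyMon (c : Fin m → ℤ) : MvPolynomial (Fin n) ℂ := ∏ i, α i ^ (c i).toNat

lemma algebraMap_polyMon {c : Fin m → ℤ} (hc : 0 ≤ c) :
    algebraMap _ (LocRing α) (polyMon α c) = mon α c := by
  rw [polyMon, mon, map_prod, Units.coe_prod]
  refine Finset.prod_congr rfl fun i _ => ?_
  obtain ⟨k, hk⟩ := Int.eq_ofNat_of_zero_le (hc i)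
  rw [hk, map_pow]
  simp [factorUnit]

lemma polyMon_mul_mon {c d : Fin m → ℤ} (h : c ≤ d) :
    algebraMap _ (LocRing α) (polyMon α (d - c)) * mon α c = mon α d := by
  rw [algebraMap_polyMon α (sub_nonneg.mpr h), ← mon_add, sub_add_cancel]

lemma exists_eq_mul_mon (f : LocRing α) : ∃ (r : MvPolynomial (Fin n) ℂ) (c : Fin m → ℤ),
    f = algebraMap _ (LocRing α) r * mon α c := by
  obtain ⟨⟨r, ⟨_, k, rfl⟩⟩, hs⟩ := IsLocalization.surj (Submonoid.powers (∏ i, α i)) f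
  refine ⟨r, fun _ => -(k : ℤ), ?_⟩
  have h1 : mon α (fun _ => (k : ℤ)) = algebraMap _ (LocRing α) ((∏ i, α i) ^ k) := by
    rw [← algebraMap_polyMon α (fun _ => by simp), polyMon]
    simp [Finset.prod_pow]
  have h2 : mon α (fun _ => (k : ℤ)) * mon α (fun _ => -(k : ℤ)) = 1 := by
    rw [← mon_add, ← mon_zero α]
    congr 1
    ext i
    simp
  rw [← hs, ← h1, mul_assoc, h2, mul_one]

lemma algebraMap_locRing_injective (h0 : ∀ i, α i ≠ 0) :
    Function.Injective (algebraMap (MvPolynomial (Fin n) ℂ) (LocRing α)) :=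
  IsLocalization.injective (LocRing α) (M := Submonoid.powers (∏ i, α i))
    (powers_le_nonZeroDivisors_of_noZeroDivisors (Finset.prod_ne_zero_iff.mpr fun i _ => h0 i))

/-- The logarithmic derivative of a derivation, as a homomorphism from the group of units. -/
def unitLogDeriv {A : Type*} [CommRing A] [Algebra ℂ A] (D : Derivation ℂ A A) :
    Additive Aˣ →+ A where
  toFun u := ((u.toMul⁻¹ : Aˣ) : A) * D (u.toMul : A)
  map_zero' := by simp
  map_add' u v := by
    simp only [toMul_add, mul_inv, Units.val_mul, Derivation.leibniz, smul_eq_mul]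
    linear_combination ((v.toMul⁻¹ : Aˣ) : A) * D (v.toMul : A) * u.toMul.inv_mul
      + ((u.toMul⁻¹ : Aˣ) : A) * D (u.toMul : A) * v.toMul.inv_mul

/-- The derivation of `ℂ[x]_α` along a constant vector. -/
def locDirDeriv (v : Fin n → ℂ) : Derivation ℂ (LocRing α) (LocRing α) :=
  ∑ j, v j • locPDeriv α j

lemma locDirDeriv_apply (v : Fin n → ℂ) (f : LocRing α) :
    locDirDeriv α v f = ∑ j, v j • locPDeriv α j f := by
  rw [locDirDeriv, ← Derivation.coeFnAddMonoidHom_apply, map_sum, Finset.sum_apply]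
  rfl

lemma locDirDeriv_algebraMap (v : Fin n → ℂ) (p : MvPolynomial (Fin n) ℂ) :
    locDirDeriv α v (algebraMap _ (LocRing α) p) = algebraMap _ (LocRing α) (dirDeriv v p) := by
  rw [locDirDeriv_apply, dirDeriv_apply, map_sum]
  refine Finset.sum_congr rfl fun j _ => ?_
  rw [locPDeriv_algebraMap, ← algebraMap_smul (LocRing α) (v j), ← algebraMap_smul
    (MvPolynomial (Fin n) ℂ) (v j), smul_eq_mul, smul_eq_mul, map_mul,
    ← IsScalarTower.algebraMap_apply]

lemma locDirDeriv_mon (hd : ∀ i, (α i).totalDegree ≤ 1) (v : Fin n → ℂ) (c : Fin m → ℤ) :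
    locDirDeriv α v (mon α c)
      = ∑ i, ((c i : ℂ) * linCoeff α i v) • mon α (c - Pi.single i 1) := by
  -- The logarithmic derivative is additive on units, so positive and negative exponents are treated
  -- alike.
  have h1 := map_sum (unitLogDeriv (locDirDeriv α v))
    (fun i => c i • Additive.ofMul (factorUnit α i)) Finset.univ
  simp only [map_zsmul] at h1
  have h2 : (∑ i, c i • Additive.ofMul (factorUnit α i)).toMul = ∏ i, factorUnit α i ^ c i := by
    simp
  have h3 : mon α c * unitLogDeriv (locDirDeriv α v) (∑ i, c i • Additive.ofMul (factorUnit α i))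
      = locDirDeriv α v (mon α c) := by
    simp only [unitLogDeriv, AddMonoidHom.coe_mk, ZeroHom.coe_mk, h2, mon]
    rw [← mul_assoc, Units.mul_inv, one_mul]
  rw [← h3, h1, Finset.mul_sum]
  refine Finset.sum_congr rfl fun i _ => ?_
  have h5 : unitLogDeriv (locDirDeriv α v) (Additive.ofMul (factorUnit α i))
      = ((factorUnit α i)⁻¹ : (LocRing α)ˣ) * algebraMap ℂ (LocRing α) (linCoeff α i v) := by
    simp only [unitLogDeriv, AddMonoidHom.coe_mk, ZeroHom.coe_mk, toMul_ofMul]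
    congr 1
    change locDirDeriv α v (algebraMap _ (LocRing α) (α i)) = _
    rw [locDirDeriv_algebraMap, dirDeriv_factor α hd, ← algebraMap_eq,
      ← IsScalarTower.algebraMap_apply]
  rw [h5, sub_eq_add_neg, mon_add, mon_neg_single, Algebra.smul_def, zsmul_eq_mul, map_mul, map_intCast]
  ring

/-- The twisted directional derivative `∇_v`, acting on coefficients of `α^β`. -/
def nabla (v : Fin n → ℂ) : Module.End ℂ (LocRing α) := ∑ j, v j • twistedD α β j

lemma nabla_apply (hd : ∀ i, (α i).totalDegree ≤ 1) (v : Fin n → ℂ) (f : LocRing α) :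
    nabla α β v f = locDirDeriv α v f
      + (∑ i, (β i * linCoeff α i v) • mon α (-Pi.single i 1)) * f := by
  have h1 : ∑ j, v j • logDerivCoeff α β j
      = ∑ i, (β i * linCoeff α i v) • mon α (-Pi.single i 1) := by
    simp only [logDerivCoeff, Finset.smul_sum]
    rw [Finset.sum_comm]
    refine Finset.sum_congr rfl fun i _ => ?_
    rw [linCoeff, Finset.mul_sum, Finset.sum_smul]
    refine Finset.sum_congr rfl fun j _ => ?_
    rw [pderiv_eq_C_of_totalDegree_le_one (hd i), ← algebraMap_eq,
      ← IsScalarTower.algebraMap_apply, mon_neg_single, ← Algebra.smul_def, smul_smul, smul_smul]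
    congr 1
    ring
  rw [← h1, nabla, LinearMap.sum_apply, locDirDeriv_apply, Finset.sum_mul,
    ← Finset.sum_add_distrib]
  refine Finset.sum_congr rfl fun j _ => ?_
  rw [LinearMap.smul_apply, twistedD, LinearMap.add_apply, smul_add, LinearMap.mulLeft_apply,
    smul_mul_assoc]
  rfl

lemma nabla_mul (hd : ∀ i, (α i).totalDegree ≤ 1) (v : Fin n → ℂ)
    (r : MvPolynomial (Fin n) ℂ) (f : LocRing α) :
    nabla α β v (r • f) = r • nabla α β v f + dirDeriv v r • f := by
  rw [nabla_apply α β hd, nabla_apply α β hd, Algebra.smul_def r, Derivation.leibniz,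
    locDirDeriv_algebraMap, smul_eq_mul, smul_eq_mul, Algebra.smul_def r,
    Algebra.smul_def (dirDeriv v r)]
  ring

/-- The scalar `β i + c i` is the true exponent of `α i` in `α^c α^β`. Its vanishing gives stability
of the pole modules, and its non-vanishing lets derivatives change pole orders. -/
lemma nabla_mon (hd : ∀ i, (α i).totalDegree ≤ 1) (v : Fin n → ℂ) (c : Fin m → ℤ) :
    nabla α β v (mon α c)
      = ∑ i, ((β i + c i) * linCoeff α i v) • mon α (c - Pi.single i 1) := by
  rw [nabla_apply α β hd, locDirDeriv_mon α hd, Finset.sum_mul, ← Finset.sum_add_distrib]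
  refine Finset.sum_congr rfl fun i _ => ?_
  rw [smul_mul_assoc, ← mon_add, neg_add_eq_sub, ← add_smul]
  congr 1
  ring

lemma polyMon_smul_mon {c d : Fin m → ℤ} (h : c ≤ d) :
    polyMon α (d - c) • mon α c = mon α d := by
  rw [Algebra.smul_def, polyMon_mul_mon α h]

lemma factor_smul_mon (i : Fin m) (c : Fin m → ℤ) :
    α i • mon α c = mon α (c + Pi.single i 1) := by
  rw [Algebra.smul_def, ← mon_single, ← mon_add, add_comm]

lemma exists_eq_smul_mon (f : LocRing α) : ∃ (r : MvPolynomial (Fin n) ℂ) (c : Fin m → ℤ),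
    f = r • mon α c := by
  obtain ⟨r, c, h⟩ := exists_eq_mul_mon α f
  exact ⟨r, c, by rw [h, Algebra.smul_def]⟩

/-- The exponent vector of `∏ i ∈ Y, α_i`. -/
def expInd (Y : Finset (Fin m)) : Fin m → ℤ := fun i => if i ∈ Y then 1 else 0

lemma expInd_nonneg (Y : Finset (Fin m)) : 0 ≤ expInd Y := fun i => by
  unfold expInd
  split_ifs <;> simp

lemma single_le_expInd {Y : Finset (Fin m)} {i : Fin m} (hi : i ∈ Y) :
    Pi.single i 1 ≤ expInd Y := fun j => by
  by_cases hj : j = i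
  · subst hj
    simp [expInd, hi]
  · rw [Pi.single_eq_of_ne hj]
    exact expInd_nonneg Y j

lemma polyMon_nsmul_expInd (Y : Finset (Fin m)) (k : ℕ) :
    polyMon α (k • expInd Y) = (∏ i ∈ Y, α i) ^ k := by
  rw [polyMon, ← Finset.prod_pow, ← Finset.prod_subset (Finset.subset_univ Y)]
  · exact Finset.prod_congr rfl fun i hi => by simp [expInd, hi]
  · exact fun i _ hi => by simp [expInd, hi]

/-- `Y` holds the factors along which the derivative is not controlled; the new poles along them are
put over one common denominator. -/
lemma nabla_mon_of_vanish (hd : ∀ i, (α i).totalDegree ≤ 1) (v : Fin n → ℂ) (c : Fin m → ℤ)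
    (Y : Finset (Fin m)) (h : ∀ j ∉ Y, (β j + c j) * linCoeff α j v = 0) :
    ∃ q : MvPolynomial (Fin n) ℂ, nabla α β v (mon α c) = q • mon α (c - expInd Y) := by
  refine ⟨∑ j ∈ Y, ((β j + c j) * linCoeff α j v) • polyMon α (expInd Y - Pi.single j 1), ?_⟩
  rw [nabla_mon α β hd, Finset.sum_smul, ← Finset.sum_subset (Finset.subset_univ Y)]
  · refine Finset.sum_congr rfl fun j hj => ?_
    rw [smul_assoc, ← polyMon_smul_mon α (sub_le_sub_left (single_le_expInd hj) c)]
    congr 3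
    abel
  · intro j _ hj
    rw [h j hj, zero_smul]

lemma nabla_mon_of_dual (hd : ∀ i, (α i).totalDegree ≤ 1) (v : Fin n → ℂ) (c : Fin m → ℤ)
    (Y : Finset (Fin m)) {i : Fin m} (hi : i ∉ Y) (hv : linCoeff α i v = 1)
    (h : ∀ j ∉ Y, j ≠ i → (β j + c j) * linCoeff α j v = 0) :
    ∃ q : MvPolynomial (Fin n) ℂ, nabla α β v (mon α c)
      = (β i + c i) • mon α (c - Pi.single i 1) + q • mon α (c - expInd Y) := by
  refine ⟨∑ j ∈ Y, ((β j + c j) * linCoeff α j v) • polyMon α (expInd Y - Pi.single j 1), ?_⟩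
  rw [nabla_mon α β hd, Finset.sum_smul, ← Finset.sum_subset (Finset.subset_univ (insert i Y)),
    Finset.sum_insert hi, hv, mul_one]
  · congr 1
    refine Finset.sum_congr rfl fun j hj => ?_
    rw [smul_assoc, ← polyMon_smul_mon α (sub_le_sub_left (single_le_expInd hj) c)]
    congr 3
    abel
  · intro j _ hj
    rw [Finset.mem_insert, not_or] at hj
    rw [h j hj.2 hj.1, zero_smul]

/-- The Euler operator `α_i ∇_v`, with `v` dual to `α_i`, acts on monomials by a scalar up to terms
of higher order along `α_i`. -/
lemma euler_smul_mon (hd : ∀ i, (α i).totalDegree ≤ 1) (v : Fin n → ℂ) (c : Fin m → ℤ)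
    (Y : Finset (Fin m)) {i : Fin m} (hi : i ∉ Y) (hv : linCoeff α i v = 1)
    (h : ∀ j ∉ Y, j ≠ i → (β j + c j) * linCoeff α j v = 0) (r : MvPolynomial (Fin n) ℂ) :
    ∃ q : MvPolynomial (Fin n) ℂ, α i • nabla α β v (r • mon α c)
      = (β i + c i) • r • mon α c + q • mon α (c + Pi.single i 1 - expInd Y) := by
  obtain ⟨q, hq⟩ := nabla_mon_of_dual α β hd v c Y hi hv h
  -- The second summand is the Leibniz term `α i • dirDeriv v r • mon α c`, rewritten over the same
  -- denominator.
  refine ⟨r * q + dirDeriv v r * polyMon α (expInd Y), ?_⟩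
  have h1 : α i • mon α (c - Pi.single i 1) = mon α c := by
    rw [factor_smul_mon, sub_add_cancel]
  have h2 : α i • mon α (c - expInd Y) = mon α (c + Pi.single i 1 - expInd Y) := by
    rw [factor_smul_mon, sub_add_eq_add_sub]
  have h3 : polyMon α (expInd Y) • mon α (c + Pi.single i 1 - expInd Y)
      = α i • mon α c := by
    have h4 := polyMon_smul_mon α (sub_le_self (c + Pi.single i 1) (expInd_nonneg Y))
    rw [sub_sub_cancel] at h4
    rw [h4, factor_smul_mon]
  rw [nabla_mul α β hd, hq]
  generalize β i + (c i : ℂ) = γ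
  rw [smul_add, smul_add, smul_add, add_smul (r * q), mul_smul, mul_smul, h3, ← h2,
    smul_comm r γ, smul_comm (α i) γ, smul_comm (α i) r, h1, smul_comm (α i) r, smul_comm (α i) q,
    smul_comm (α i) (dirDeriv v r), add_assoc]

end Calculus

/-! ### Torsion modulo a submodule -/

section Torsion

variable {R M ι : Type*} [CommRing R] [AddCommGroup M] [Module R M]

/-- The ring elements acting injectively on the image of `Z` modulo `U` form a submonoid. -/
lemma mem_of_prod_pow_smul_mem {Z U : Submodule R M} {Y : Finset ι} {a : ι → R}
    (h : ∀ j ∈ Y, ∀ z ∈ Z, a j • z ∈ U → z ∈ U) {z : M} (hz : z ∈ Z) {k : ℕ}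
    (hk : (∏ j ∈ Y, a j) ^ k • z ∈ U) : z ∈ U := by
  let G : Submonoid R :=
    { carrier := {r | ∀ z ∈ Z, r • z ∈ U → z ∈ U}
      one_mem' := fun z _ h => by rwa [one_smul] at h
      mul_mem' := fun {r s} hr hs z hz h =>
        hs z hz (hr _ (Z.smul_mem s hz) (by rwa [smul_smul])) }
  exact pow_mem (prod_mem (S := G) h) k z hz hk

/-- When finitely many commuting elements act locally nilpotently, every nonzero element has a
nonzero multiple killed by all of them. So it suffices to exclude such elements from `Z` modulo `U`.
-/
lemma le_of_torsion {Z U : Submodule R M} {X : Finset ι} {a : ι → R}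
    (hnil : ∀ z ∈ Z, ∀ i ∈ X, ∃ k : ℕ, a i ^ k • z ∈ U)
    (h : ∀ z ∈ Z, (∀ i ∈ X, a i • z ∈ U) → z ∈ U) : Z ≤ U := by
  classical
  induction X using Finset.induction_on with
  | empty => exact fun z hz => h z hz (by simp)
  | insert i X hi ih =>
    refine ih (fun z hz j hj => hnil z hz j (Finset.mem_insert_of_mem hj)) fun z hz hX => ?_
    obtain ⟨k, hk⟩ := hnil z hz i (Finset.mem_insert_self i X)
    induction k generalizing z with
    | zero => simpa using hk
    | succ k ihk =>
      refine h z hz fun j hj => ?_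
      obtain rfl | hj := Finset.mem_insert.mp hj
      · refine ihk _ (Z.smul_mem _ hz) (fun l hl => ?_) (by rwa [smul_smul, ← pow_succ])
        rw [smul_comm]
        exact U.smul_mem _ (hX l hl)
      · exact hX j hj

end Torsion

/-! ### Elements with prescribed poles -/

section PoleModule

variable {n m : ℕ} (α : Fin m → MvPolynomial (Fin n) ℂ) (β : Fin m → ℂ)

/-- An `R`-submodule stable under all the operators `∇_v`. -/
def IsDStable (U : Submodule (MvPolynomial (Fin n) ℂ) (LocRing α)) : Prop :=
  ∀ v, ∀ f ∈ U, nabla α β v f ∈ U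

variable (I : Finset (Fin m)) (b : Fin m → ℤ)

/-- The elements of `ℂ[x]_α α^β` with poles along the `V(α_i)`, `i ∈ I`, only for `i ∈ S`. Here
`b i` is the value of `β i` for `i ∈ I`. -/
def poleModule (S : Finset (Fin m)) : Submodule (MvPolynomial (Fin n) ℂ) (LocRing α) where
  carrier := {f | ∃ (r : MvPolynomial (Fin n) ℂ) (c : Fin m → ℤ),
    (∀ i ∈ I, i ∉ S → -b i ≤ c i) ∧ f = r • mon α c}
  zero_mem' := ⟨0, fun i => -b i, by simp, by simp⟩
  add_mem' := by
    rintro _ _ ⟨r, c, hc, rfl⟩ ⟨s, d, hd, rfl⟩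
    refine ⟨r * polyMon α (c - c ⊓ d) + s * polyMon α (d - c ⊓ d), c ⊓ d,
      fun i hi hS => le_inf (hc i hi hS) (hd i hi hS), ?_⟩
    rw [add_smul, mul_smul, mul_smul, polyMon_smul_mon α inf_le_left,
      polyMon_smul_mon α inf_le_right]
  smul_mem' := by
    rintro s _ ⟨r, c, hc, rfl⟩
    exact ⟨s * r, c, hc, by rw [mul_smul]⟩

variable {I b}

lemma smul_mon_mem_poleModule {S : Finset (Fin m)} (r : MvPolynomial (Fin n) ℂ) {c : Fin m → ℤ}
    (hc : ∀ i ∈ I, i ∉ S → -b i ≤ c i) : r • mon α c ∈ poleModule α I b S := ⟨r, c, hc, rfl⟩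

lemma mon_mem_poleModule {S : Finset (Fin m)} {c : Fin m → ℤ}
    (hc : ∀ i ∈ I, i ∉ S → -b i ≤ c i) : mon α c ∈ poleModule α I b S :=
  ⟨1, c, hc, (one_smul _ _).symm⟩

lemma poleModule_mono {S T : Finset (Fin m)} (h : S ⊆ T) :
    poleModule α I b S ≤ poleModule α I b T := by
  rintro _ ⟨r, c, hc, rfl⟩
  exact ⟨r, c, fun i hi hT => hc i hi fun hS => hT (h hS), rfl⟩

/-- Lowering an exponent only costs a polynomial factor, so exponents can be normalized to `-b i`
where no pole is allowed and pushed below any bound elsewhere. -/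
lemma exists_of_mem_poleModule {S : Finset (Fin m)} {f : LocRing α} (hf : f ∈ poleModule α I b S)
    (c₀ : Fin m → ℤ) : ∃ (r : MvPolynomial (Fin n) ℂ) (c : Fin m → ℤ),
      (∀ i ∈ I, i ∉ S → c i = -b i) ∧ (∀ i, (i ∈ I → i ∈ S) → c i ≤ c₀ i) ∧ f = r • mon α c := by
  obtain ⟨r, c, hc, rfl⟩ := hf
  have hle : (fun i => if i ∈ I ∧ i ∉ S then -b i else min (c i) (c₀ i)) ≤ c := by
    intro i
    dsimp only
    split_ifs with h
    · exact hc i h.1 h.2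
    · exact min_le_left _ _
  refine ⟨r * polyMon α (c - _), _, fun i hi hS => ?_, fun i hi => ?_,
    by rw [mul_smul, polyMon_smul_mon α hle]⟩
  · simp [hi, hS]
  · rw [if_neg (by tauto)]
    exact min_le_right _ _

/-- The only terms that could create a forbidden pole have `c i = -b i`, and their coefficient `β i
+ c i` is zero. -/
lemma poleModule_isDStable (hd : ∀ i, (α i).totalDegree ≤ 1) (hb : ∀ i ∈ I, β i = b i)
    (S : Finset (Fin m)) : IsDStable α β (poleModule α I b S) := by
  rintro v _ ⟨r, c, hc, rfl⟩
  rw [nabla_mul α β hd, nabla_mon α β hd]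
  refine add_mem (Submodule.smul_mem _ _ (sum_mem fun i _ => ?_)) (smul_mon_mem_poleModule α _ hc)
  by_cases h : i ∈ I ∧ i ∉ S ∧ c i = -b i
  · rw [hb i h.1, h.2.2]
    simp
  · refine Submodule.smul_of_tower_mem _ _ (mon_mem_poleModule α fun j hj hS => ?_)
    by_cases hij : j = i
    · subst hij
      have := hc j hj hS
      have : c j ≠ -b j := fun h' => h ⟨hj, hS, h'⟩
      simp only [Pi.sub_apply, Pi.single_eq_same]
      omega
    · simpa [Pi.single_eq_of_ne hij] using hc j hj hS

lemma exists_pow_smul_mem_poleModule {S : Finset (Fin m)} {f : LocRing α}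
    (hf : f ∈ poleModule α I b S) (i : Fin m) :
    ∃ k : ℕ, α i ^ k • f ∈ poleModule α I b (S.erase i) := by
  obtain ⟨r, c, hc, rfl⟩ := hf
  have hpow : ∀ k : ℕ, α i ^ k • mon α c = mon α (c + k • Pi.single i 1) := by
    intro k
    induction k with
    | zero => simp
    | succ k ih => rw [pow_succ', mul_smul, ih, factor_smul_mon, succ_nsmul, add_assoc]
  refine ⟨(-b i - c i).toNat, ?_⟩
  rw [smul_comm, hpow]
  refine smul_mon_mem_poleModule α r fun j hj hS => ?_
  by_cases hij : j = i
  · subst hij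
    rw [Pi.add_apply, Pi.smul_apply, Pi.single_eq_same, nsmul_eq_mul, mul_one]
    have := Int.self_le_toNat (-b j - c j)
    omega
  · simpa [Pi.single_eq_of_ne hij] using hc j hj (by simpa [hij] using hS)

lemma factor_smul_mon_mem_poleModule {P : Finset (Fin m)} {j : Fin m} (hj : j ∈ P)
    {c : Fin m → ℤ} (hc : ∀ i ∈ I, c i = -b i - expInd P i) :
    α j • mon α c ∈ poleModule α I b (P.erase j) := by
  rw [factor_smul_mon]
  refine mon_mem_poleModule α fun i hi hiP => ?_
  rw [Pi.add_apply, hc i hi]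
  by_cases hij : i = j
  · subst hij
    simp [expInd, hj]
  · have : i ∉ P := fun h => hiP (Finset.mem_erase.mpr ⟨hij, h⟩)
    simp [expInd, this, Pi.single_eq_of_ne hij]

lemma IsDStable.iSup {ι : Sort*} {U : ι → Submodule (MvPolynomial (Fin n) ℂ) (LocRing α)}
    (h : ∀ i, IsDStable α β (U i)) : IsDStable α β (⨆ i, U i) := by
  intro v f hf
  induction hf using Submodule.iSup_induction' with
  | mem i f hf => exact (le_iSup U i) (h i v f hf)
  | zero => simp
  | add f g _ _ hf hg => rw [map_add]; exact add_mem hf hg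

end PoleModule

/-! ### Flats of an arrangement in general position -/

section Geometry

variable {n m : ℕ} {α : Fin m → MvPolynomial (Fin n) ℂ}

lemma eval_eq_add_linCoeff {i : Fin m} (hd : (α i).totalDegree ≤ 1) (v : Fin n → ℂ) :
    eval v (α i) = coeff 0 (α i) + linCoeff α i v := by
  conv_lhs => rw [eq_linear_of_totalDegree_le_one hd]
  simp [linCoeff, mul_comm]

lemma mem_flat {S : Finset (Fin m)} {v : Fin n → ℂ} : v ∈ flat α S ↔ ∀ i ∈ S, eval v (α i) = 0 := by
  simp [flat, zeroSet]

variable (α) in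
/-- The linear parts of the `α i`, as linear forms. -/
def linForm (i : Fin m) : (Fin n → ℂ) →ₗ[ℂ] ℂ :=
  Fintype.linearCombination ℂ fun j => coeff (Finsupp.single j 1) (α i)

lemma linForm_apply (i : Fin m) (v : Fin n → ℂ) : linForm α i v = linCoeff α i v := by
  simp [linForm, linCoeff, Fintype.linearCombination_apply]

variable (hα : InGeneralPosition α)
include hα

/-- The common kernel of the linear parts lies in the direction of the flat, of dimension `n -
S.card`. By rank-nullity the linear parts map onto `S → ℂ`, and the `D i` are preimages of the
standard basis. -/
lemma InGeneralPosition.exists_dual {S : Finset (Fin m)} (hS : S.card ≤ n) :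
    ∃ D : Fin m → Fin n → ℂ, ∀ i ∈ S, ∀ j ∈ S, linCoeff α j (D i) = if j = i then 1 else 0 := by
  classical
  let Λ : (Fin n → ℂ) →ₗ[ℂ] (S → ℂ) := LinearMap.pi fun i => linForm α i
  obtain ⟨p, hp⟩ := hα.nonempty_of_card_le S hS
  have hker : LinearMap.ker Λ ≤ vectorSpan ℂ (flat α S) := by
    intro w hw
    have hpw : p + w ∈ flat α S := by
      rw [mem_flat] at hp ⊢
      intro i hi
      have hwi : linForm α i w = 0 := congrFun hw ⟨i, hi⟩
      have := hp i hi
      rw [eval_eq_add_linCoeff (hα.degree_one i).le, ← linForm_apply] at this ⊢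
      rw [map_add, hwi, add_zero, this]
    simpa using vsub_mem_vectorSpan ℂ hpw hp
  have h1 := Submodule.finrank_mono hker
  have h2 := hα.dim_of_card_le S hS
  have h3 := LinearMap.finrank_range_add_finrank_ker Λ
  have h4 : LinearMap.range Λ = ⊤ := by
    apply Submodule.eq_top_of_finrank_eq
    refine le_antisymm (Submodule.finrank_le _) ?_
    simp only [Module.finrank_fintype_fun_eq_card, Fintype.card_coe, Fintype.card_fin] at h3 ⊢
    omega
  choose D hD using fun i : S => LinearMap.range_eq_top.mp h4 (Pi.single i 1)
  refine ⟨fun i => if h : i ∈ S then D ⟨i, h⟩ else 0, fun i hi j hj => ?_⟩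
  have := congrFun (hD ⟨i, hi⟩) ⟨j, hj⟩
  simp only [dif_pos hi, ← linForm_apply]
  refine (this : linForm α j _ = _).trans ?_
  simp [Pi.single_apply]

/-- Nullstellensatz: the hyperplanes have no common point. -/
lemma InGeneralPosition.span_eq_top {S : Finset (Fin m)} (hS : n < S.card) :
    Ideal.span (α '' S) = ⊤ := by
  rw [← Ideal.radical_eq_top, ← vanishingIdeal_zeroLocus_eq_radical (K := ℂ)]
  have : zeroLocus ℂ (Ideal.span (α '' (S : Set (Fin m)))) = ∅ := by
    rw [← hα.empty_of_card_gt S hS, zeroLocus_span]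
    ext v
    simp [mem_flat]
  rw [this, vanishingIdeal_empty]

/-- Otherwise adjoining `l` would not change the flat, whereas its dimension must drop, or the flat
must become empty when `P.card = n`. -/
lemma InGeneralPosition.notMem_span {P : Finset (Fin m)} (hP : P.card ≤ n) {l : Fin m}
    (hl : l ∉ P) : α l ∉ Ideal.span (α '' P) := by
  classical
  intro h
  have hflat : flat α (insert l P) = flat α P := by
    ext v
    simp only [mem_flat, Finset.forall_mem_insert, and_iff_right_iff_imp]
    intro hv
    have hle : Ideal.span (α '' (P : Set (Fin m))) ≤ RingHom.ker (eval v) := by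
      rw [Ideal.span_le]
      rintro _ ⟨i, hi, rfl⟩
      exact hv i hi
    exact hle h
  have hcard := Finset.card_insert_of_notMem hl
  by_cases hn : P.card < n
  · have h1 := hα.dim_of_card_le P hP
    have h2 := hα.dim_of_card_le (insert l P) (by omega)
    rw [hflat] at h2
    omega
  · have h1 := hα.nonempty_of_card_le P hP
    rw [← hflat, hα.empty_of_card_gt _ (by omega)] at h1
    exact Set.not_nonempty_empty h1

omit hα

variable (α) in
/-- The pullback along the projection onto `flat α P` in the directions `D i`, `i ∈ P`. -/
def flatProj (P : Finset (Fin m)) (D : Fin m → Fin n → ℂ) :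
    MvPolynomial (Fin n) ℂ →ₐ[ℂ] MvPolynomial (Fin n) ℂ :=
  aeval fun k => X k - ∑ j ∈ P, D j k • α j

variable {P : Finset (Fin m)} {D : Fin m → Fin n → ℂ}

lemma sub_flatProj_mem (g : MvPolynomial (Fin n) ℂ) :
    g - flatProj α P D g ∈ Ideal.span (α '' P) := by
  rw [← Ideal.Quotient.mk_eq_mk_iff_sub_mem]
  have h : (Ideal.Quotient.mkₐ ℂ (Ideal.span (α '' (P : Set (Fin m))))).comp (flatProj α P D)
      = Ideal.Quotient.mkₐ ℂ _ := by
    apply algHom_ext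
    intro k
    simp only [AlgHom.comp_apply, flatProj, aeval_X, Ideal.Quotient.mkₐ_eq_mk, map_sub]
    rw [sub_eq_self, ← RingHom.mem_ker, Ideal.mk_ker]
    refine sum_mem fun j hj => Submodule.smul_of_tower_mem _ _ ?_
    exact Ideal.subset_span ⟨j, hj, rfl⟩
  exact (congrArg (fun φ => φ g) h).symm

lemma flatProj_factor_eq {l : Fin m} (hd : (α l).totalDegree ≤ 1) :
    flatProj α P D (α l) = α l - ∑ j ∈ P, linCoeff α l (D j) • α j := by
  conv_lhs => rw [eq_linear_of_totalDegree_le_one hd]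
  conv_rhs => rw [eq_linear_of_totalDegree_le_one hd]
  simp only [map_add, map_sum, map_mul, flatProj, aeval_C, aeval_X, algebraMap_eq, mul_sub,
    Finset.sum_sub_distrib, Finset.mul_sum, linCoeff, Finset.sum_smul]
  rw [Finset.sum_comm, add_sub_assoc]
  congr 2
  refine Finset.sum_congr rfl fun j _ => Finset.sum_congr rfl fun k _ => ?_
  rw [← smul_eq_C_mul, smul_smul, mul_comm]

lemma flatProj_factor (hd : ∀ i, (α i).totalDegree ≤ 1)
    (hD : ∀ i ∈ P, ∀ j ∈ P, linCoeff α j (D i) = if j = i then 1 else 0) {l : Fin m} (hl : l ∈ P) :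
    flatProj α P D (α l) = 0 := by
  rw [flatProj_factor_eq (hd l), Finset.sum_eq_single l, hD l hl l hl]
  · simp
  · intro j hj hjl
    rw [hD j hj l hl, if_neg hjl.symm, zero_smul]
  · exact fun h => absurd hl h

/-- The projection fixes polynomials modulo the ideal of the flat and kills its generators, so
`flatProj` represents restriction to the flat inside the polynomial ring itself. -/
lemma flatProj_eq_zero_iff (hd : ∀ i, (α i).totalDegree ≤ 1)
    (hD : ∀ i ∈ P, ∀ j ∈ P, linCoeff α j (D i) = if j = i then 1 else 0)
    {g : MvPolynomial (Fin n) ℂ} : flatProj α P D g = 0 ↔ g ∈ Ideal.span (α '' P) := by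
  constructor
  · intro h
    simpa [h] using sub_flatProj_mem (P := P) (α := α) (D := D) g
  · intro h
    have hle : Ideal.span (α '' (P : Set (Fin m))) ≤ RingHom.ker (flatProj α P D) := by
      rw [Ideal.span_le]
      rintro _ ⟨i, hi, rfl⟩
      exact flatProj_factor hd hD hi
    exact hle h

lemma dirDeriv_X (v : Fin n → ℂ) (k : Fin n) :
    dirDeriv v (X k : MvPolynomial (Fin n) ℂ) = C (v k) := by
  classical
  simp [dirDeriv_apply, pderiv_X, Pi.single_apply, smul_eq_C_mul]

/-- Chain rule: the differential of the projection is `v ↦ v - ∑ j ∈ P, linCoeff α j v • D j`. -/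
lemma dirDeriv_flatProj (hd : ∀ i, (α i).totalDegree ≤ 1) (v : Fin n → ℂ)
    (g : MvPolynomial (Fin n) ℂ) :
    dirDeriv v (flatProj α P D g)
      = flatProj α P D (dirDeriv (v - ∑ j ∈ P, linCoeff α j v • D j) g) := by
  induction g using MvPolynomial.induction_on with
  | C a => simp [flatProj]
  | add p q hp hq => simp only [map_add, hp, hq]
  | mul_X p k hp =>
    simp only [map_mul, Derivation.leibniz, hp, smul_eq_mul, map_add, dirDeriv_X]
    congr 2
    simp only [flatProj, aeval_X, aeval_C, algebraMap_eq, map_sub, map_sum, Derivation.map_smul,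
      dirDeriv_X, dirDeriv_factor α hd, Pi.sub_apply, Finset.sum_apply, Pi.smul_apply]
    congr 1
    refine Finset.sum_congr rfl fun j _ => ?_
    rw [smul_eq_C_mul, smul_eq_mul, map_mul, mul_comm]

/-- In characteristic zero a nonconstant polynomial has a nonzero partial derivative, of smaller
degree; repeated differentiation ends at a nonzero constant. -/
lemma exists_C_mem_of_pderiv_stable {K : Set (MvPolynomial (Fin n) ℂ)}
    (hK : ∀ g ∈ K, ∀ j, pderiv j g ∈ K) {g : MvPolynomial (Fin n) ℂ} (hg : g ∈ K) (h0 : g ≠ 0) :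
    ∃ c : ℂ, c ≠ 0 ∧ C c ∈ K := by
  obtain ⟨d, hd⟩ : ∃ d, ∀ s : Fin n →₀ ℕ, d < s.degree → coeff s g = 0 :=
    ⟨g.totalDegree, fun s hs => by
      by_contra h
      exact absurd (le_totalDegree (mem_support_iff.mpr h)) (not_le.mpr hs)⟩
  induction d generalizing g with
  | zero =>
    have hgC : g = C (coeff 0 g) := by
      ext s
      by_cases hs : s = 0
      · simp [hs]
      · rw [coeff_C, if_neg (Ne.symm hs),
          hd s (Nat.pos_of_ne_zero ((Finsupp.degree_eq_zero_iff s).not.mpr hs))]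
    exact ⟨coeff 0 g, fun h => h0 (by rw [hgC, h, map_zero]), hgC ▸ hg⟩
  | succ d ih =>
    by_cases hall : ∀ j, pderiv j g = 0
    · refine ih hg h0 fun s hs => ?_
      have hs0 : s ≠ 0 := fun h => by simp [h] at hs
      obtain ⟨i, hi⟩ := Finsupp.ne_iff.mp hs0
      have h1 := coeff_pderiv (i := i) g (s - Finsupp.single i 1)
      rw [hall i, coeff_zero, tsub_add_cancel_of_le
        (Finsupp.single_le_iff.mpr (Nat.one_le_iff_ne_zero.mpr hi))] at h1
      exact (mul_eq_zero.mp h1.symm).resolve_right (Nat.cast_add_one_ne_zero _)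
    · push Not at hall
      obtain ⟨j, hj⟩ := hall
      refine ih (hK g hg j) hj fun s hs => ?_
      rw [coeff_pderiv, hd _ (by simpa using hs), zero_mul]

end Geometry

/-! ### Leading terms along a flat -/

section Residue

variable {n m : ℕ} {α : Fin m → MvPolynomial (Fin n) ℂ}

variable (α) in
/-- Taylor expansion along `flat α P` in the directions `D j`, `j ∈ P`. -/
def normalExpansion (P : Finset (Fin m)) (D : Fin m → Fin n → ℂ) :
    MvPolynomial (Fin n) ℂ →ₐ[ℂ] MvPolynomial (Fin m) (MvPolynomial (Fin n) ℂ) :=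
  aeval fun k => C (flatProj α P D (X k)) + ∑ j ∈ P, D j k • X j

variable {P : Finset (Fin m)} {D : Fin m → Fin n → ℂ}

/-- For dual `D`, this sends `α j` to the variable `X j` when `j ∈ P`, while for other factors the
constant term is the restriction to the flat. -/
lemma normalExpansion_factor {l : Fin m} (hd : (α l).totalDegree ≤ 1) :
    normalExpansion α P D (α l) = C (flatProj α P D (α l)) + ∑ j ∈ P, linCoeff α l (D j) • X j := by
  have h (a : ℂ) : algebraMap ℂ (MvPolynomial (Fin m) (MvPolynomial (Fin n) ℂ)) a = C (C a) := by
    rw [IsScalarTower.algebraMap_apply ℂ (MvPolynomial (Fin n) ℂ), algebraMap_eq, algebraMap_eq]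
  conv_lhs => rw [eq_linear_of_totalDegree_le_one hd]
  conv_rhs => rw [eq_linear_of_totalDegree_le_one hd]
  have h' (a : ℂ) : flatProj α P D (C a) = C a := by simp [flatProj]
  simp only [map_add, map_sum, map_mul, h']
  simp only [normalExpansion, aeval_C, aeval_X, h, mul_add,
    Finset.sum_add_distrib, Finset.mul_sum, linCoeff, Finset.sum_smul]
  rw [Finset.sum_comm (s := P), add_assoc]
  congr 2
  refine Finset.sum_congr rfl fun j _ => Finset.sum_congr rfl fun k _ => ?_
  rw [← h, ← Algebra.smul_def, smul_smul, mul_comm]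

lemma coeff_eq_zero_of_mem_span_pow {σ A : Type*} [CommRing A] {P : Finset σ} {e : ℕ}
    {p : MvPolynomial σ A} (hp : p ∈ Ideal.span ((fun j => (X j : MvPolynomial σ A) ^ e) '' P))
    {s : σ →₀ ℕ} (hs : ∀ j ∈ P, s j < e) : coeff s p = 0 := by
  have himg : (fun j => (X j : MvPolynomial σ A) ^ e) '' P
      = (fun t => monomial t (1 : A)) '' ((fun j => Finsupp.single j e) '' P) := by
    rw [Set.image_image]
    simp only [X_pow_eq_monomial]
  rw [himg, mem_ideal_span_monomial_image] at hp
  by_contra h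
  obtain ⟨_, ⟨j, hj, rfl⟩, hle⟩ := hp s (mem_support_iff.mpr h)
  have := hle j
  simp only [Finsupp.single_eq_same] at this
  exact absurd (hs j hj) (not_lt.mpr this)

/-- Multiplying by a large monomial clears all denominators; a summand regular along `j` then keeps
the full factor `α j ^ e`. -/
lemma mem_span_pow_of_mem_iSup_poleModule {I : Finset (Fin m)} {b : Fin m → ℤ} (hPI : P ⊆ I)
    {f : LocRing α} (hf : f ∈ ⨆ j : P, poleModule α I b (Finset.univ.erase j)) :
    ∃ N : ℕ, ∀ e : ℕ, N ≤ e → ∃ p ∈ Ideal.span ((fun j => α j ^ e) '' P),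
      algebraMap _ (LocRing α) p = mon α (fun i => e + b i) * f := by
  induction hf using Submodule.iSup_induction' with
  | mem j f hf =>
    obtain ⟨r, c, hc, rfl⟩ := hf
    refine ⟨∑ i, (-(b i + c i)).toNat, fun e he => ?_⟩
    have h0 : (0 : Fin m → ℤ) ≤ (fun i => (e : ℤ) + b i) + c := fun i => by
      have h1 := Finset.single_le_sum (f := fun i => (-(b i + c i)).toNat)
        (fun _ _ => Nat.zero_le _) (Finset.mem_univ i)
      have h2 := Int.self_le_toNat (-(b i + c i))
      simp only [Pi.zero_apply, Pi.add_apply]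
      omega
    refine ⟨r * polyMon α ((fun i => (e : ℤ) + b i) + c), Ideal.mul_mem_left _ _ ?_, ?_⟩
    · have hdvd : α j ^ e ∣ polyMon α ((fun i => (e : ℤ) + b i) + c) := by
        refine (pow_dvd_pow _ ?_).trans (Finset.dvd_prod_of_mem _ (Finset.mem_univ (j : Fin m)))
        have := hc j (hPI j.2) (by simp)
        simp only [Pi.add_apply]
        omega
      exact Ideal.mem_of_dvd _ hdvd (Ideal.subset_span ⟨j, j.2, rfl⟩)
    · rw [map_mul, algebraMap_polyMon α h0, mon_add, Algebra.smul_def]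
      ring
  | zero => exact ⟨0, fun e _ => ⟨0, zero_mem _, by simp⟩⟩
  | add f g _ _ hf hg =>
    obtain ⟨N₁, h₁⟩ := hf
    obtain ⟨N₂, h₂⟩ := hg
    refine ⟨max N₁ N₂, fun e he => ?_⟩
    obtain ⟨p, hp, hp'⟩ := h₁ e (le_of_max_le_left he)
    obtain ⟨q, hq, hq'⟩ := h₂ e (le_of_max_le_right he)
    exact ⟨p + q, add_mem hp hq, by rw [map_add, hp', hq', mul_add]⟩

/-- The monomial with simple poles exactly along `P` is not a sum of elements each regular along
some component of `P`. -/
lemma InGeneralPosition.mon_notMem_iSup (hα : InGeneralPosition α) {I : Finset (Fin m)}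
    {b : Fin m → ℤ} (hPI : P ⊆ I) (hP : P.card ≤ n) :
    mon α (-b - expInd P) ∉ ⨆ j : P, poleModule α I b (Finset.univ.erase j) := by
  classical
  intro hmem
  have hd := fun i => (hα.degree_one i).le
  obtain ⟨D, hD⟩ := hα.exists_dual hP
  obtain ⟨N, hN⟩ := mem_span_pow_of_mem_iSup_poleModule hPI hmem
  -- With `e = N + 1` the simple poles leave exponent exactly `N` along `P`, one less than the
  -- generators of the ideal require.
  obtain ⟨p, hp, hpe⟩ := hN (N + 1) (Nat.le_succ N)
  have hexp : (fun i => ((N + 1 : ℕ) : ℤ) + b i) + (-b - expInd P)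
      = fun i => if i ∈ P then (N : ℤ) else N + 1 := by
    ext i
    simp only [Pi.add_apply, Pi.sub_apply, Pi.neg_apply, expInd]
    split_ifs <;> push_cast <;> ring
  rw [← mon_add, hexp, ← algebraMap_polyMon α (fun i => by dsimp only; split_ifs <;> positivity)]
    at hpe
  have h0 : ∀ i, α i ≠ 0 := fun i h => by simpa [h] using hα.degree_one i
  have hpeq := algebraMap_locRing_injective α h0 hpe
  have hfac : ∀ j ∈ P, normalExpansion α P D (α j) = X j := by
    intro j hj
    rw [normalExpansion_factor (hd j), flatProj_factor hd hD hj, map_zero, zero_add,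
      Finset.sum_eq_single j, hD j hj j hj, if_pos rfl, one_smul]
    · intro i hi hij
      rw [hD i hi j hj, if_neg hij.symm, zero_smul]
    · exact fun h => absurd hj h
  have hφ : normalExpansion α P D p ∈ Ideal.span ((fun j => (X j :
      MvPolynomial (Fin m) (MvPolynomial (Fin n) ℂ)) ^ (N + 1)) '' P) := by
    have h1 := Ideal.mem_map_of_mem (normalExpansion α P D) hp
    rw [Ideal.map_span, Set.image_image] at h1
    refine (congrArg (fun s => _ ∈ Ideal.span s) (Set.image_congr fun j hj => ?_)).mp h1
    rw [map_pow, hfac j hj]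
  -- No monomial of the ideal generated by the `X j ^ (N + 1)` divides this multidegree, so the
  -- coefficient at `s` must vanish.
  let s : Fin m →₀ ℕ := ∑ j ∈ P, Finsupp.single j N
  have hs : ∀ j ∈ P, s j = N := fun j hj => by
    simp [s, Finsupp.finsetSum_apply, Finsupp.single_apply, hj]
  have hcoeff := coeff_eq_zero_of_mem_span_pow hφ (s := s) fun j hj => by
    rw [hs j hj]
    exact Nat.lt_succ_self N
  have hsplit : normalExpansion α P D p
      = monomial s 1 * ∏ l ∈ Finset.univ \ P, normalExpansion α P D (α l) ^ (N + 1) := by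
    rw [hpeq, polyMon, map_prod, ← Finset.prod_sdiff (Finset.subset_univ P), mul_comm]
    congr 1
    · rw [monomial_sum_one]
      refine Finset.prod_congr rfl fun j hj => ?_
      rw [if_pos hj, Int.toNat_natCast, map_pow, hfac j hj, X_pow_eq_monomial]
    · refine Finset.prod_congr rfl fun l hl => ?_
      rw [if_neg (Finset.mem_sdiff.mp hl).2, map_pow]
      rfl
  -- Computed directly, that coefficient is a product of powers of the restrictions of `α l`, `l ∉
  -- P`, to the flat, none of which is zero.
  have hconst := coeff_monomial_mul 0 s 1
    (∏ l ∈ Finset.univ \ P, normalExpansion α P D (α l) ^ (N + 1))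
  rw [add_zero, ← hsplit, hcoeff, one_mul, ← constantCoeff_eq, map_prod, eq_comm,
    Finset.prod_eq_zero_iff] at hconst
  obtain ⟨l, hl, hl0⟩ := hconst
  rw [map_pow] at hl0
  have hl1 := pow_eq_zero_iff (Nat.succ_ne_zero N) |>.mp hl0
  rw [normalExpansion_factor (hd l)] at hl1
  have hl2 : flatProj α P D (α l) = 0 := by
    simpa [map_sum, constantCoeff_smul] using hl1
  exact hα.notMem_span hP (Finset.mem_sdiff.mp hl).2 ((flatProj_eq_zero_iff hd hD).mp hl2)

end Residue

/-! ### Reduction to simple poles -/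

section Simplicity

variable {n m : ℕ} {α : Fin m → MvPolynomial (Fin n) ℂ} {β : Fin m → ℂ}
  {U : Submodule (MvPolynomial (Fin n) ℂ) (LocRing α)}

lemma IsDStable.smul_nabla_add_mem (hd : ∀ i, (α i).totalDegree ≤ 1) (hU : IsDStable α β U)
    {i : Fin m} {v : Fin n → ℂ} (hv : linCoeff α i v = 1) {w : LocRing α} (hw : α i • w ∈ U) :
    α i • nabla α β v w + w ∈ U := by
  have h := hU v _ hw
  rwa [nabla_mul α β hd, dirDeriv_factor α hd, hv, map_one, one_smul] at h

/-- If `α_i` kills `r α^c` modulo `U`, then `r α^c` can be replaced modulo `U` by an element of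
higher order along `α_i`. -/
lemma IsDStable.exists_sub_smul_mon_mem (hd : ∀ i, (α i).totalDegree ≤ 1) (hU : IsDStable α β U)
    {i : Fin m} {v : Fin n → ℂ} {Y : Finset (Fin m)} (hi : i ∉ Y) (hv : linCoeff α i v = 1)
    {c : Fin m → ℤ} (h : ∀ j ∉ Y, j ≠ i → (β j + c j) * linCoeff α j v = 0)
    (hc : β i + c i + 1 ≠ 0) {r : MvPolynomial (Fin n) ℂ} (hr : α i • r • mon α c ∈ U) :
    ∃ q : MvPolynomial (Fin n) ℂ,
      r • mon α c - q • mon α (c + Pi.single i 1 - expInd Y) ∈ U := by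
  obtain ⟨q, hq⟩ := euler_smul_mon α β hd v c Y hi hv h r
  have h1 := hU.smul_nabla_add_mem hd hv hr
  rw [hq] at h1
  -- Leibniz on `α i • w` and the Euler formula together put `(β i + c i + 1) r α^c` plus a higher
  -- order term in `U`.
  have h2 := Submodule.smul_of_tower_mem U (β i + c i + 1)⁻¹ h1
  refine ⟨-((β i + c i + 1)⁻¹ • q), ?_⟩
  convert h2 using 1
  generalize r • mon α c = f
  rw [neg_smul, sub_neg_eq_add, smul_assoc]
  generalize q • mon α _ = g
  have h3 : (β i + c i) • f + g + f = (β i + c i + 1) • f + g := by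
    rw [add_smul _ (1 : ℂ), one_smul]
    abel
  rw [h3, smul_add, inv_smul_smul₀ hc]

variable {I P : Finset (Fin m)} {b : Fin m → ℤ}

lemma expInd_compl_apply {i : Fin m} (hi : i ∈ I) : expInd Iᶜ i = 0 := by simp [expInd, hi]

/-- An element of `poleModule α I b P` killed modulo `U` by the `α j`, `j ∈ P`, is congruent to one
with simple poles along `P`. -/
lemma IsDStable.exists_simple_pole (hd : ∀ i, (α i).totalDegree ≤ 1) (hU : IsDStable α β U)
    (hb : ∀ i ∈ I, β i = b i) (hPI : P ⊆ I) {D : Fin m → Fin n → ℂ}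
    (hD : ∀ i ∈ P, ∀ j ∈ P, linCoeff α j (D i) = if j = i then 1 else 0)
    {f : LocRing α} (hf : f ∈ poleModule α I b P) (hP : ∀ j ∈ P, α j • f ∈ U) :
    ∃ (g : MvPolynomial (Fin n) ℂ) (c : Fin m → ℤ),
      (∀ j ∈ I, c j = -b j - expInd P j) ∧ f - g • mon α c ∈ U := by
  obtain ⟨r, c, hc0, hcP, rfl⟩ := exists_of_mem_poleModule α hf (fun i => -b i - 1)
  replace hcP : ∀ j ∈ P, c j ≤ -b j - 1 := fun j hj => hcP j fun _ => hj
  -- Induction on the total excess of the pole orders over simple poles.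
  obtain ⟨k, hk⟩ : ∃ k, ∑ j ∈ P, (-b j - 1 - c j).toNat = k := ⟨_, rfl⟩
  clear hf
  induction k generalizing r c with
  | zero =>
    refine ⟨r, c, fun j hj => ?_, by simp⟩
    by_cases hjP : j ∈ P
    · have h1 := Finset.sum_eq_zero_iff.mp hk j hjP
      have h2 := hcP j hjP
      simp only [expInd, if_pos hjP]
      omega
    · simp [expInd, hjP, hc0 j hj hjP]
  | succ k ih =>
    obtain ⟨i, hi, hik⟩ : ∃ i ∈ P, (-b i - 1 - c i).toNat ≠ 0 := by
      by_contra! h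
      rw [Finset.sum_eq_zero h] at hk
      omega
    obtain ⟨q, hq⟩ := hU.exists_sub_smul_mon_mem hd (Y := Iᶜ) (c := c) (r := r) (v := D i)
      (by simpa using hPI hi) (by rw [hD i hi i hi, if_pos rfl])
      (fun j hj hji => by
        by_cases hjP : j ∈ P
        · rw [hD i hi j hjP, if_neg hji, mul_zero]
        · have hjI : j ∈ I := by simpa using hj
          rw [hb j hjI, hc0 j hjI hjP]
          simp)
      -- The scalar `b i + c i + 1` vanishes only at a simple pole, and the pole along `i` is of
      -- higher order.
      (by
        rw [hb i (hPI hi)]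
        intro h
        have : b i + c i + 1 = 0 := by exact_mod_cast h
        omega)
      (hP i hi)
    have hval : ∀ j ∈ I, (c + Pi.single i 1 - expInd Iᶜ : Fin m → ℤ) j
        = c j + (Pi.single i 1 : Fin m → ℤ) j := by
      intro j hj
      simp [expInd_compl_apply hj]
    obtain ⟨g, d, hdc, hg⟩ := ih q (c + Pi.single i 1 - expInd Iᶜ)
      (fun j hj hjP => by
        rw [hval j hj, hc0 j hj hjP, Pi.single_eq_of_ne (ne_of_mem_of_not_mem hi hjP).symm, add_zero])
      (fun j hj => by
        have := sub_mem (hP j hj) (U.smul_mem (α j) hq)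
        rwa [smul_sub, sub_sub_cancel] at this)
      (fun j hj => by
        rw [hval j (hPI hj)]
        by_cases hji : j = i
        · subst hji
          rw [Pi.single_eq_same]
          omega
        · simpa [Pi.single_eq_of_ne hji] using hcP j hj)
      (by
        rw [← Finset.add_sum_erase _ _ hi] at hk ⊢
        have h1 : ∑ j ∈ P.erase i, (-b j - 1 - (c + Pi.single i 1 - expInd Iᶜ : Fin m → ℤ) j).toNat
            = ∑ j ∈ P.erase i, (-b j - 1 - c j).toNat := by
          refine Finset.sum_congr rfl fun j hj => ?_
          rw [hval j (hPI (Finset.mem_of_mem_erase hj)),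
            Pi.single_eq_of_ne (Finset.ne_of_mem_erase hj), add_zero]
        rw [h1, hval i (hPI hi), Pi.single_eq_same]
        omega)
    refine ⟨g, d, hdc, ?_⟩
    simpa using add_mem hq hg

lemma dirDeriv_single (j : Fin n) (g : MvPolynomial (Fin n) ℂ) :
    dirDeriv (Pi.single j 1) g = pderiv j g := by
  classical
  rw [dirDeriv_apply, Finset.sum_eq_single j]
  · simp
  · intro k _ hk
    simp [Pi.single_eq_of_ne hk]
  · simp

variable (hd : ∀ i, (α i).totalDegree ≤ 1) (hU : IsDStable α β U)
    (hb : ∀ i ∈ I, β i = b i) (hPI : P ⊆ I)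
    (hsub : ∀ j ∈ P, poleModule α I b (P.erase j) ≤ U)

include hd hU hb hsub in
/-- A stable submodule containing `g α^c` with `g` nonzero on the flat of `P` and simple poles along
`P` contains such a monomial. -/
lemma IsDStable.exists_mon_mem {D : Fin m → Fin n → ℂ}
    (hD : ∀ i ∈ P, ∀ j ∈ P, linCoeff α j (D i) = if j = i then 1 else 0)
    {g : MvPolynomial (Fin n) ℂ} (hg : g ∉ Ideal.span (α '' P)) {c : Fin m → ℤ}
    (hc : ∀ j ∈ I, c j = -b j - expInd P j) (hgc : g • mon α c ∈ U) :
    ∃ d : Fin m → ℤ, (∀ j ∈ I, d j = -b j - expInd P j) ∧ mon α d ∈ U := by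
  -- The exponents outside `I` are left free, which makes `J` closed under sums: two monomials are
  -- both multiplied up to their supremum.
  let J : Ideal (MvPolynomial (Fin n) ℂ) :=
    { carrier := {g | ∃ c : Fin m → ℤ, (∀ j ∈ I, c j = -b j - expInd P j) ∧ g • mon α c ∈ U}
      zero_mem' := ⟨c, hc, by simp⟩
      add_mem' := by
        rintro g₁ g₂ ⟨c₁, h₁, h₁'⟩ ⟨c₂, h₂, h₂'⟩
        refine ⟨c₁ ⊔ c₂, fun j hj => by simp [h₁ j hj, h₂ j hj], ?_⟩
        rw [add_smul]
        refine add_mem ?_ ?_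
        · rw [← polyMon_smul_mon α (le_sup_left : c₁ ≤ c₁ ⊔ c₂), smul_comm]
          exact U.smul_mem _ h₁'
        · rw [← polyMon_smul_mon α (le_sup_right : c₂ ≤ c₁ ⊔ c₂), smul_comm]
          exact U.smul_mem _ h₂'
      smul_mem' := by
        rintro s g ⟨c, h, h'⟩
        exact ⟨c, h, by rw [smul_eq_mul, mul_smul]; exact U.smul_mem _ h'⟩ }
  have hJP : Ideal.span (α '' (P : Set (Fin m))) ≤ J := by
    rw [Ideal.span_le]
    rintro _ ⟨j, hj, rfl⟩
    exact ⟨c, hc, hsub j hj (factor_smul_mon_mem_poleModule α hj hc)⟩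
  have hstable : ∀ v, (∀ j ∈ P, linCoeff α j v = 0) → ∀ g ∈ J, dirDeriv v g ∈ J := by
    rintro v hv g ⟨c, hc, hgc⟩
    obtain ⟨q, hq⟩ := nabla_mon_of_vanish α β hd v c Iᶜ fun j hj => by
      by_cases hjP : j ∈ P
      · rw [hv j hjP, mul_zero]
      · have hjI : j ∈ I := by simpa using hj
        rw [hb j hjI, hc j hjI]
        simp [expInd, hjP]
    refine ⟨c + expInd Iᶜ, fun j hj => by rw [Pi.add_apply, expInd_compl_apply hj, add_zero, hc j hj],
      ?_⟩
    have h1 := hU v _ hgc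
    rw [nabla_mul α β hd, hq] at h1
    have h2 : polyMon α (expInd Iᶜ) • mon α c = mon α (c + expInd Iᶜ) := by
      simpa using polyMon_smul_mon α (le_add_of_nonneg_right (a := c) (expInd_nonneg Iᶜ))
    have h3 : polyMon α (expInd Iᶜ) • mon α (c - expInd Iᶜ) = mon α c := by
      simpa using polyMon_smul_mon α (sub_le_self c (expInd_nonneg Iᶜ))
    -- Multiplying by the factors outside `I` removes the poles created there; what remains besides
    -- the derivative of `g` is a multiple of `g α^c`.
    have h4 := U.smul_mem (polyMon α (expInd Iᶜ)) h1
    rw [smul_add, smul_comm _ (dirDeriv v g), h2, smul_comm _ g, smul_comm _ q, h3,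
      smul_comm g q] at h4
    exact (Submodule.add_mem_iff_right U (U.smul_mem q hgc)).mp h4
  -- On the flat every partial derivative comes from a tangent direction, so the image of `J` is
  -- stable under all of them.
  obtain ⟨a, ha, g₀, hg₀, hag⟩ := exists_C_mem_of_pderiv_stable (K := flatProj α P D '' J)
    (by
      rintro _ ⟨g, hg, rfl⟩ j
      refine ⟨_, hstable _ ?_ g hg, by rw [← dirDeriv_single, dirDeriv_flatProj hd]⟩
      intro i hi
      rw [← linForm_apply, map_sub, map_sum, Finset.sum_eq_single i]
      · rw [map_smul, linForm_apply, linForm_apply, hD i hi i hi]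
        simp
      · intro l hl hli
        rw [map_smul, linForm_apply, hD l hl i hi, if_neg hli.symm, smul_zero]
      · exact fun h => absurd hi h)
    ⟨g, ⟨c, hc, hgc⟩, rfl⟩ ((flatProj_eq_zero_iff hd hD).not.mpr hg)
  have hCa : C a ∈ J := by
    rw [← hag, ← sub_sub_cancel g₀ (flatProj α P D g₀)]
    exact sub_mem hg₀ (hJP (sub_flatProj_mem g₀))
  have h1 : (1 : MvPolynomial (Fin n) ℂ) ∈ J := by
    have := J.mul_mem_left (C a⁻¹) hCa
    rwa [← map_mul, inv_mul_cancel₀ ha, map_one] at this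
  obtain ⟨d, hd, hd'⟩ := h1
  exact ⟨d, hd, by rwa [one_smul] at hd'⟩

include hd hU hb hPI in
-- Once a pole along `i ∈ P` is present, the derivative along `D i` raises its order with a nonzero
-- coefficient. This reaches all prescribed pole orders along `P`, with no control on the exponents
-- outside `I`.
lemma IsDStable.exists_mon_mem_of_poles {D : Fin m → Fin n → ℂ}
    (hD : ∀ i ∈ P, ∀ j ∈ P, linCoeff α j (D i) = if j = i then 1 else 0)
    {d : Fin m → ℤ} (hd' : ∀ j ∈ I, d j = -b j - expInd P j) (hdU : mon α d ∈ U)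
    {c : Fin m → ℤ} (hc0 : ∀ j ∈ I, j ∉ P → c j = -b j) (hcP : ∀ j ∈ P, c j ≤ -b j - 1) :
    ∃ e : Fin m → ℤ, (∀ j ∈ I, e j = c j) ∧ mon α e ∈ U := by
  obtain ⟨k, hk⟩ : ∃ k, ∑ j ∈ P, (-b j - 1 - c j).toNat = k := ⟨_, rfl⟩
  induction k generalizing c with
  | zero =>
    refine ⟨d, fun j hj => ?_, hdU⟩
    rw [hd' j hj]
    by_cases hjP : j ∈ P
    · have h1 := Finset.sum_eq_zero_iff.mp hk j hjP
      have h2 := hcP j hjP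
      simp only [expInd, if_pos hjP]
      omega
    · simp [expInd, hjP, hc0 j hj hjP]
  | succ k ih =>
    obtain ⟨i, hi, hik⟩ : ∃ i ∈ P, (-b i - 1 - c i).toNat ≠ 0 := by
      by_contra! h
      rw [Finset.sum_eq_zero h] at hk
      omega
    obtain ⟨e, he, heU⟩ := ih (c := c + Pi.single i 1)
      (fun j hj hjP => by
        rw [Pi.add_apply, hc0 j hj hjP, Pi.single_eq_of_ne (ne_of_mem_of_not_mem hi hjP).symm, add_zero])
      (fun j hj => by
        rw [Pi.add_apply]
        by_cases hji : j = i
        · subst hji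
          rw [Pi.single_eq_same]
          omega
        · simpa [Pi.single_eq_of_ne hji] using hcP j hj)
      (by
        rw [← Finset.add_sum_erase _ _ hi] at hk ⊢
        have h1 : ∑ j ∈ P.erase i, (-b j - 1 - (c + Pi.single i 1 : Fin m → ℤ) j).toNat
            = ∑ j ∈ P.erase i, (-b j - 1 - c j).toNat := by
          refine Finset.sum_congr rfl fun j hj => ?_
          rw [Pi.add_apply, Pi.single_eq_of_ne (Finset.ne_of_mem_erase hj), add_zero]
        rw [h1, Pi.add_apply, Pi.single_eq_same]
        omega)
    obtain ⟨q, hq⟩ := nabla_mon_of_dual α β hd (D i) e Iᶜ (i := i)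
      (by simpa using hPI hi) (by rw [hD i hi i hi, if_pos rfl])
      (fun j hj hji => by
        by_cases hjP : j ∈ P
        · rw [hD i hi j hjP, if_neg hji, mul_zero]
        · have hjI : j ∈ I := by simpa using hj
          rw [hb j hjI, he j hjI, Pi.add_apply, hc0 j hjI hjP, Pi.single_eq_of_ne hji]
          simp)
    have h1 := U.smul_mem (polyMon α (expInd Iᶜ)) (hU (D i) _ heU)
    have h2 : polyMon α (expInd Iᶜ) • mon α (e - Pi.single i 1)
        = mon α (e - Pi.single i 1 + expInd Iᶜ) := by
      simpa using polyMon_smul_mon α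
        (le_add_of_nonneg_right (a := e - Pi.single i 1) (expInd_nonneg Iᶜ))
    have h3 : polyMon α (expInd Iᶜ) • mon α (e - expInd Iᶜ) = mon α e := by
      simpa using polyMon_smul_mon α (sub_le_self e (expInd_nonneg Iᶜ))
    have hγ : β i + e i ≠ 0 := by
      rw [hb i (hPI hi), he i (hPI hi), Pi.add_apply, Pi.single_eq_same]
      intro h
      have : b i + (c i + 1) = 0 := by exact_mod_cast h
      omega
    rw [hq, smul_add, smul_comm _ (β i + _ : ℂ), h2, smul_comm _ q, h3,
      Submodule.add_mem_iff_left U (U.smul_mem q heU)] at h1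
    refine ⟨e - Pi.single i 1 + expInd Iᶜ, fun j hj => ?_, ?_⟩
    · simp [expInd_compl_apply hj, he j hj]
    · have := Submodule.smul_of_tower_mem U (β i + e i)⁻¹ h1
      rwa [inv_smul_smul₀ hγ] at this

end Simplicity

/-! ### Simplicity of the successive quotients -/

section PoleModuleSimple

variable {n m : ℕ} {α : Fin m → MvPolynomial (Fin n) ℂ} {β : Fin m → ℂ}
  {U : Submodule (MvPolynomial (Fin n) ℂ) (LocRing α)} {I P : Finset (Fin m)} {b : Fin m → ℤ}

/-- If `α^e ∈ U` and the `α i`, `i ∈ T`, kill `r α^c` modulo `U`, then so does a power of the product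
of the remaining factors. -/
lemma IsDStable.exists_pow_smul_mem (hd : ∀ i, (α i).totalDegree ≤ 1) (hU : IsDStable α β U)
    (hb : ∀ i ∈ I, β i = b i) (hnon : ∀ i ∉ I, ¬ ∃ z : ℤ, β i = z)
    {T : Finset (Fin m)} (hPT : P ⊆ T) {D : Fin m → Fin n → ℂ}
    (hD : ∀ i ∈ T, ∀ j ∈ T, linCoeff α j (D i) = if j = i then 1 else 0)
    {e : Fin m → ℤ} (he : mon α e ∈ U) {r : MvPolynomial (Fin n) ℂ} {c : Fin m → ℤ}
    (hc0 : ∀ j ∈ I, j ∉ P → c j = -b j) (hce : ∀ j ∈ I, e j = c j)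
    (hr : ∀ i ∈ T, α i • r • mon α c ∈ U) :
    ∃ k : ℕ, (∏ i ∈ Iᶜ \ T, α i) ^ k • r • mon α c ∈ U := by
  -- Exponents `c i` with `i ∈ T \ I` are raised one by one towards `e i`, each time at the cost of
  -- one factor `∏ i ∈ Iᶜ \ T, α i`. The Euler scalar never vanishes because `β i` is not an
  -- integer.
  obtain ⟨k, hk⟩ : ∃ k, ∑ j ∈ T \ I, (e j - c j).toNat = k := ⟨_, rfl⟩
  induction k generalizing r c with
  | zero =>
    -- Only the indices in `Iᶜ \ T` can still fall short of `e`; the total deficit bounds each of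
    -- their deficits.
    refine ⟨∑ j, (e j - c j).toNat, ?_⟩
    set K := ∑ j, (e j - c j).toNat with hK
    have hle : e ≤ c + K • expInd (Iᶜ \ T) := by
      intro j
      rw [Pi.add_apply, Pi.smul_apply, nsmul_eq_mul]
      by_cases hjI : j ∈ I
      · simp [hce j hjI, expInd, hjI]
      by_cases hjT : j ∈ T
      · have h1 := Finset.sum_eq_zero_iff.mp hk j (Finset.mem_sdiff.mpr ⟨hjT, hjI⟩)
        simp only [expInd, Finset.mem_sdiff, hjT, not_true_eq_false, and_false, if_false, mul_zero]
        omega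
      · have h1 := Finset.single_le_sum (f := fun j => (e j - c j).toNat)
          (fun _ _ => Nat.zero_le _) (Finset.mem_univ j)
        rw [← hK] at h1
        simp only [expInd, Finset.mem_sdiff, Finset.mem_compl, hjT, hjI, not_false_eq_true,
          and_self, if_true, mul_one]
        omega
    have h1 := polyMon_smul_mon α
      (le_add_of_nonneg_right (a := c) (nsmul_nonneg (expInd_nonneg (Iᶜ \ T)) K))
    rw [add_sub_cancel_left, polyMon_nsmul_expInd] at h1
    rw [smul_comm, h1, ← polyMon_smul_mon α hle]
    exact U.smul_mem _ (U.smul_mem _ he)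
  | succ k ih =>
    obtain ⟨i, hi, hik⟩ : ∃ i ∈ T \ I, (e i - c i).toNat ≠ 0 := by
      by_contra! h
      rw [Finset.sum_eq_zero h] at hk
      omega
    obtain ⟨hiT, hiI⟩ := Finset.mem_sdiff.mp hi
    obtain ⟨q, hq⟩ := hU.exists_sub_smul_mon_mem hd (Y := Iᶜ \ T) (c := c) (r := r) (v := D i)
      (by simp [hiT]) (by rw [hD i hiT i hiT, if_pos rfl])
      (fun j hj hji => by
        by_cases hjT : j ∈ T
        · rw [hD i hiT j hjT, if_neg hji, mul_zero]
        · have hjI : j ∈ I := by simpa [hjT] using hj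
          rw [hb j hjI, hc0 j hjI fun h => hjT (hPT h)]
          simp)
      (fun h => hnon i hiI ⟨-c i - 1, by push_cast; linear_combination h⟩)
      (hr i hiT)
    have hY : (∏ i ∈ Iᶜ \ T, α i) • mon α (c + Pi.single i 1 - expInd (Iᶜ \ T))
        = mon α (c + Pi.single i 1) := by
      have h1 := polyMon_smul_mon α (sub_le_self (c + Pi.single i 1) (expInd_nonneg (Iᶜ \ T)))
      rwa [sub_sub_cancel, ← one_nsmul (expInd _), polyMon_nsmul_expInd, pow_one,
        one_nsmul] at h1
    have hq' := U.smul_mem (∏ i ∈ Iᶜ \ T, α i) hq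
    rw [smul_sub, smul_comm _ q, hY] at hq'
    obtain ⟨K, hK⟩ := ih (r := q) (c := c + Pi.single i 1)
      (fun j hj hjP => by
        rw [Pi.add_apply, hc0 j hj hjP, Pi.single_eq_of_ne (ne_of_mem_of_not_mem hj hiI), add_zero])
      (fun j hj => by
        rw [Pi.add_apply, Pi.single_eq_of_ne (ne_of_mem_of_not_mem hj hiI), add_zero, hce j hj])
      (fun j hj => by
        have h1 := U.smul_mem (∏ i ∈ Iᶜ \ T, α i) (hr j hj)
        rw [smul_comm] at h1
        have := sub_mem h1 (U.smul_mem (α j) hq')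
        rwa [← smul_sub, sub_sub_cancel] at this)
      (by
        rw [← Finset.add_sum_erase _ _ hi] at hk ⊢
        have h1 : ∑ j ∈ (T \ I).erase i, (e j - (c + Pi.single i 1 : Fin m → ℤ) j).toNat
            = ∑ j ∈ (T \ I).erase i, (e j - c j).toNat := by
          refine Finset.sum_congr rfl fun j hj => ?_
          rw [Pi.add_apply, Pi.single_eq_of_ne (Finset.ne_of_mem_erase hj), add_zero]
        rw [h1, Pi.add_apply, Pi.single_eq_same]
        omega)
    refine ⟨K + 1, ?_⟩
    rw [pow_succ, mul_smul]
    have h1 := U.smul_mem ((∏ i ∈ Iᶜ \ T, α i) ^ K) hq'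
    rw [smul_sub] at h1
    exact (Submodule.sub_mem_iff_left U hK).mp h1

variable (hα : InGeneralPosition α) (hU : IsDStable α β U) (hb : ∀ i ∈ I, β i = b i)
  (hnon : ∀ i ∉ I, ¬ ∃ z : ℤ, β i = z) (hPI : P ⊆ I)
  (hsub : ∀ j ∈ P, poleModule α I b (P.erase j) ≤ U)

include hα hU hb hnon hPI hsub in
-- Descending induction on a set `T` of factors that kill an element modulo `U`. With more than `n`
-- factors the unit ideal kills it. Otherwise some product of powers of factors outside `T` sends it
-- into `U`, and by the larger case each such factor acts injectively modulo `U`.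
lemma IsDStable.poleModule_le_of_mon_mem {D : Fin m → Fin n → ℂ}
    (hD : ∀ i ∈ P, ∀ j ∈ P, linCoeff α j (D i) = if j = i then 1 else 0)
    {d : Fin m → ℤ} (hd' : ∀ j ∈ I, d j = -b j - expInd P j) (hdU : mon α d ∈ U) :
    poleModule α I b P ≤ U := by
  have hd := fun i => (hα.degree_one i).le
  suffices h : ∀ k, ∀ T ⊆ Iᶜ ∪ P, ((Iᶜ ∪ P) \ T).card = k →
      ∀ w ∈ poleModule α I b P, (∀ i ∈ T, α i • w ∈ U) → w ∈ U from
    fun w hw => h _ ∅ (Finset.empty_subset _) rfl w hw (by simp)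
  intro k
  induction k using Nat.strong_induction_on with
  | _ k ih =>
    intro T hT hk w hw hTw
    let Z := poleModule α I b P ⊓ ⨅ i : T, U.comap (LinearMap.lsmul _ (LocRing α) (α i))
    have hZ : ∀ {z}, z ∈ Z ↔ z ∈ poleModule α I b P ∧ ∀ i ∈ T, α i • z ∈ U := by
      intro z
      simp [Z, Submodule.mem_iInf]
    have hinsert : ∀ j ∈ (Iᶜ ∪ P) \ T, ∀ z ∈ Z, α j • z ∈ U → z ∈ U := by
      intro j hj z hz hjz
      obtain ⟨hjQ, hjT⟩ := Finset.mem_sdiff.mp hj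
      refine ih _ ?_ (insert j T) (Finset.insert_subset hjQ hT) rfl z (hZ.mp hz).1 ?_
      · rw [← hk]
        refine Finset.card_lt_card (Finset.ssubset_iff_subset_ne.mpr
          ⟨Finset.sdiff_subset_sdiff le_rfl (Finset.subset_insert _ _), fun h => ?_⟩)
        rw [← h] at hj
        simp at hj
      · intro i hi
        obtain rfl | hi := Finset.mem_insert.mp hi
        · exact hjz
        · exact (hZ.mp hz).2 i hi
    have hwZ : w ∈ Z := hZ.mpr ⟨hw, hTw⟩
    by_cases hPT : P ⊆ T
    · by_cases hTn : n < T.card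
      · have hle : Ideal.span (α '' (T : Set (Fin m))) ≤
            U.comap (LinearMap.toSpanSingleton (MvPolynomial (Fin n) ℂ) (LocRing α) w) := by
          rw [Ideal.span_le]
          rintro _ ⟨j, hj, rfl⟩
          exact hTw j hj
        rw [hα.span_eq_top hTn] at hle
        simpa using hle (Submodule.mem_top (x := 1))
      · obtain ⟨E, hE⟩ := hα.exists_dual (not_lt.mp hTn)
        obtain ⟨r, c, hc0, hcP, rfl⟩ := exists_of_mem_poleModule α hw fun i => -b i - 1
        replace hcP : ∀ j ∈ P, c j ≤ -b j - 1 := fun j hj => hcP j fun _ => hj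
        obtain ⟨e, hec, heU⟩ := hU.exists_mon_mem_of_poles hd hb hPI hD hd' hdU hc0 hcP
        obtain ⟨K, hK⟩ := hU.exists_pow_smul_mem hd hb hnon hPT hE heU hc0 hec hTw
        refine mem_of_prod_pow_smul_mem (fun j hj => hinsert j ?_) hwZ hK
        exact Finset.sdiff_subset_sdiff Finset.subset_union_left le_rfl hj
    · obtain ⟨j, hjP, hjT⟩ := Finset.not_subset.mp hPT
      obtain ⟨K, hK⟩ := exists_pow_smul_mem_poleModule α hw j
      refine mem_of_prod_pow_smul_mem (Y := {j}) (a := α) (k := K) (fun l hl => hinsert l ?_) hwZ ?_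
      · rw [Finset.mem_singleton.mp hl]
        simp [hjP, hjT]
      · rw [Finset.prod_singleton]
        exact hsub j hjP hK

include hα hU hb hnon hPI hsub in
/-- A stable submodule containing the `poleModule α I b (P.erase j)` and some further element of
`poleModule α I b P` contains all of `poleModule α I b P`. -/
theorem IsDStable.poleModule_le (hP : P.card ≤ n) {u : LocRing α} (hu : u ∈ U)
    (huP : u ∈ poleModule α I b P) (hu' : u ∉ ⨆ j : P, poleModule α I b (P.erase j)) :
    poleModule α I b P ≤ U := by
  have hd := fun i => (hα.degree_one i).le
  obtain ⟨D, hD⟩ := hα.exists_dual hP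
  set L := ⨆ j : P, poleModule α I b (P.erase j) with hL
  have hLU : L ≤ U := iSup_le fun j => hsub j j.2
  have hLstable : IsDStable α β L :=
    IsDStable.iSup α β fun j => poleModule_isDStable α β hd hb _
  have hjL : ∀ j ∈ P, poleModule α I b (P.erase j) ≤ L := fun j hj =>
    le_iSup (fun j : P => poleModule α I b (P.erase j)) ⟨j, hj⟩
  obtain ⟨f, hfU, hfP, hfkill, hfL⟩ : ∃ f ∈ U, f ∈ poleModule α I b P ∧
      (∀ j ∈ P, α j • f ∈ L) ∧ f ∉ L := by
    by_contra! h
    refine hu' (le_of_torsion (Z := U ⊓ poleModule α I b P) (X := P) (a := α) ?_ ?_ ⟨hu, huP⟩)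
    · rintro z ⟨_, hz⟩ i hi
      obtain ⟨k, hk⟩ := exists_pow_smul_mem_poleModule α hz i
      exact ⟨k, hjL i hi hk⟩
    · rintro z ⟨hzU, hzP⟩ hz
      exact h z hzU hzP hz
  obtain ⟨g, c, hc, hgc⟩ := hLstable.exists_simple_pole hd hb hPI hD hfP hfkill
  have hgU : g • mon α c ∈ U := (Submodule.sub_mem_iff_right U hfU).mp (hLU hgc)
  -- If `g` vanished on the flat, each term would lose a simple pole and `f` would lie in `L`.
  have hgP : g ∉ Ideal.span (α '' P) := by
    intro hg
    refine hfL ((Submodule.sub_mem_iff_left L ?_).mp hgc)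
    have hle : Ideal.span (α '' (P : Set (Fin m))) ≤
        L.comap (LinearMap.toSpanSingleton (MvPolynomial (Fin n) ℂ) (LocRing α) (mon α c)) := by
      rw [Ideal.span_le]
      rintro _ ⟨j, hj, rfl⟩
      change α j • mon α c ∈ L
      exact hjL j hj (factor_smul_mon_mem_poleModule α hj hc)
    exact hle hg
  obtain ⟨d, hdI, hdU⟩ := hU.exists_mon_mem hd hb hsub hD hgP hc hgU
  exact hU.poleModule_le_of_mon_mem hα hb hnon hPI hsub hD hdI hdU

end PoleModuleSimple

/-! ### Submodules over the Weyl algebra -/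

section WeylSubmodules

variable {n m : ℕ} {α : Fin m → MvPolynomial (Fin n) ℂ} {β : Fin m → ℂ}

lemma twistedD_eq_nabla (j : Fin n) : twistedD α β j = nabla α β (Pi.single j 1) := by
  classical
  rw [nabla, Finset.sum_eq_single j]
  · simp
  · intro k _ hk
    simp [Pi.single_eq_of_ne hk]
  · simp

lemma twistedRep_x (i : Fin n) : twistedRep α β (WeylAlgebra.x i) = twistedX α i := by
  simp only [twistedRep, WeylAlgebra.x, RingQuot.liftAlgHom_mkAlgHom_apply,
    FreeAlgebra.lift_ι_apply, Sum.elim_inl]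

lemma twistedRep_d (j : Fin n) : twistedRep α β (WeylAlgebra.d j) = twistedD α β j := by
  simp only [twistedRep, WeylAlgebra.d, RingQuot.liftAlgHom_mkAlgHom_apply,
    FreeAlgebra.lift_ι_apply, Sum.elim_inr]

lemma weyl_smul_eq (a : WeylAlgebra n) (f : LocRing α) :
    a • toTwisted α β f = toTwisted α β (twistedRep α β a f) := rfl

/-- A Weyl algebra submodule of `M_α^β`, viewed as a module over the polynomial ring. -/
def toPolySubmodule (N : Submodule (WeylAlgebra n) (TwistedModule α β)) :
    Submodule (MvPolynomial (Fin n) ℂ) (LocRing α) where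
  carrier := {f | toTwisted α β f ∈ N}
  zero_mem' := by simp
  add_mem' hf hg := N.add_mem hf hg
  smul_mem' r f hf := by
    induction r using MvPolynomial.induction_on generalizing f with
    | C a =>
      have h : algebraMap ℂ (WeylAlgebra n) a • toTwisted α β f ∈ N := N.smul_mem _ hf
      rw [weyl_smul_eq, AlgHom.commutes, Module.algebraMap_end_apply] at h
      change toTwisted α β (C a • f) ∈ N
      rwa [← algebraMap_eq, algebraMap_smul]
    | add p q hp hq =>
      rw [add_smul]
      exact N.add_mem (hp f hf) (hq f hf)
    | mul_X p i hp =>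
      rw [mul_smul]
      refine hp _ ?_
      have h : WeylAlgebra.x i • toTwisted α β f ∈ N := N.smul_mem _ hf
      rwa [weyl_x_smul, ← Algebra.smul_def] at h

lemma toPolySubmodule_mono {N N' : Submodule (WeylAlgebra n) (TwistedModule α β)} (h : N ≤ N') :
    toPolySubmodule N ≤ toPolySubmodule N' := fun _ hf => h hf

lemma toPolySubmodule_isDStable (N : Submodule (WeylAlgebra n) (TwistedModule α β)) :
    IsDStable α β (toPolySubmodule N) := by
  intro v f hf
  rw [nabla, LinearMap.sum_apply]
  refine sum_mem fun j _ => ?_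
  rw [LinearMap.smul_apply]
  refine Submodule.smul_of_tower_mem _ _ ?_
  have h : WeylAlgebra.d j • toTwisted α β f ∈ N := N.smul_mem _ hf
  rwa [weyl_smul_eq, twistedRep_d] at h

/-- The Weyl algebra submodule of `M_α^β` with a given underlying stable subspace. -/
def IsDStable.toWeyl {U : Submodule (MvPolynomial (Fin n) ℂ) (LocRing α)} (hU : IsDStable α β U) :
    Submodule (WeylAlgebra n) (TwistedModule α β) where
  carrier := {f | (toTwisted α β).symm f ∈ U}
  zero_mem' := by simp
  add_mem' hf hg := U.add_mem hf hg
  smul_mem' a f hf := by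
    obtain ⟨a, rfl⟩ := RingQuot.mkAlgHom_surjective ℂ (WeylRel n) a
    change twistedRep α β (RingQuot.mkAlgHom ℂ (WeylRel n) a) f ∈ U
    replace hf : (f : LocRing α) ∈ U := hf
    induction a using FreeAlgebra.induction generalizing f with
    | grade0 c =>
      rw [AlgHom.commutes, AlgHom.commutes]
      exact Submodule.smul_of_tower_mem U c hf
    | grade1 i =>
      cases i with
      | inl i =>
        change twistedRep α β (WeylAlgebra.x i) f ∈ U
        rw [twistedRep_x]
        have h (g : LocRing α) (hg : g ∈ U) : twistedX α i g ∈ U := by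
          have := U.smul_mem (X i) hg
          rwa [Algebra.smul_def] at this
        exact h f hf
      | inr j =>
        change twistedRep α β (WeylAlgebra.d j) f ∈ U
        rw [twistedRep_d, twistedD_eq_nabla]
        exact hU _ _ hf
    | mul a b ha hb =>
      rw [map_mul, map_mul]
      exact ha _ (hb f hf)
    | add a b ha hb =>
      rw [map_add, map_add]
      exact add_mem (ha f hf) (hb f hf)

lemma IsDStable.toWeyl_le_iff {U : Submodule (MvPolynomial (Fin n) ℂ) (LocRing α)}
    (hU : IsDStable α β U) {N : Submodule (WeylAlgebra n) (TwistedModule α β)} :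
    hU.toWeyl ≤ N ↔ U ≤ toPolySubmodule N := Iff.rfl

end WeylSubmodules

/-! ### The composition series -/

section Filtration

variable {n m : ℕ} {α : Fin m → MvPolynomial (Fin n) ℂ} {β : Fin m → ℂ}
  {I : Finset (Fin m)} {b : Fin m → ℤ}

/-- Partial fractions: modulo the right side the `α j`, `j ∈ S`, are locally nilpotent yet generate
the unit ideal, so nothing nonzero is killed by all of them. -/
lemma InGeneralPosition.poleModule_le_iSup (hα : InGeneralPosition α) {S : Finset (Fin m)}
    (hS : n < S.card) : poleModule α I b S ≤ ⨆ j : S, poleModule α I b (S.erase j) := by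
  refine le_of_torsion (X := S) (a := α) (fun z hz i hi => ?_) fun z _ hz => ?_
  · obtain ⟨k, hk⟩ := exists_pow_smul_mem_poleModule α hz i
    exact ⟨k, le_iSup (fun j : S => poleModule α I b (S.erase j)) ⟨i, hi⟩ hk⟩
  · have hle : Ideal.span (α '' (S : Set (Fin m))) ≤
        (⨆ j : S, poleModule α I b (S.erase j)).comap
          (LinearMap.toSpanSingleton (MvPolynomial (Fin n) ℂ) (LocRing α) z) := by
      rw [Ideal.span_le]
      rintro _ ⟨j, hj, rfl⟩
      exact hz j hj
    rw [hα.span_eq_top hS] at hle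
    simpa using hle (Submodule.mem_top (x := 1))

/-- The sum of the Weyl algebra modules `poleModule α I b S`, `S ∈ F`. -/
def poleSum (hd : ∀ i, (α i).totalDegree ≤ 1) (hb : ∀ i ∈ I, β i = b i)
    (F : Finset (Finset (Fin m))) : Submodule (WeylAlgebra n) (TwistedModule α β) :=
  ⨆ S ∈ F, (poleModule_isDStable α β hd hb S).toWeyl

variable (hα : InGeneralPosition α) (hd : ∀ i, (α i).totalDegree ≤ 1) (hb : ∀ i ∈ I, β i = b i)
  (hnon : ∀ i ∉ I, ¬ ∃ z : ℤ, β i = z)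

lemma poleModule_le_poleSum {F : Finset (Finset (Fin m))} {S : Finset (Fin m)} (hS : S ∈ F) :
    poleModule α I b S ≤ toPolySubmodule (poleSum hd hb F) :=
  (poleModule_isDStable α β hd hb S).toWeyl_le_iff.mp
    (le_iSup₂ (f := fun S (_ : S ∈ F) => (poleModule_isDStable α β hd hb S).toWeyl) S hS)

lemma poleSum_insert {F : Finset (Finset (Fin m))} {P : Finset (Fin m)} :
    poleSum hd hb (insert P F) = (poleModule_isDStable α β hd hb P).toWeyl ⊔ poleSum hd hb F :=
  Finset.iSup_insert _ _ _

include hα hnon in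
lemma poleSum_covBy {F : Finset (Finset (Fin m))} {P : Finset (Fin m)} (hPI : P ⊆ I)
    (hP : P.card ≤ n) (hmax : ∀ S ∈ F, ¬ P ⊆ S) (hlow : ∀ j ∈ P, P.erase j ∈ F) :
    poleSum hd hb F ⋖ poleSum hd hb (insert P F) := by
  -- Each `S ∈ F` misses some `j ∈ P`, so its elements are regular along `j`.
  have hF : ∀ S ∈ F, poleModule α I b S ≤ ⨆ j : P, poleModule α I b (Finset.univ.erase j) := by
    intro S hS
    obtain ⟨j, hjP, hjS⟩ := Finset.not_subset.mp (hmax S hS)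
    refine le_trans (poleModule_mono α fun i hi => Finset.mem_erase.mpr
      ⟨ne_of_mem_of_not_mem hi hjS, Finset.mem_univ i⟩) (le_iSup (fun j : P =>
        poleModule α I b (Finset.univ.erase j)) ⟨j, hjP⟩)
  have hQ : IsDStable α β (⨆ j : P, poleModule α I b (Finset.univ.erase j)) :=
    IsDStable.iSup α β fun j => poleModule_isDStable α β hd hb _
  have hmem : mon α (-b - expInd P) ∈ poleModule α I b P :=
    mon_mem_poleModule α fun i _ hiP => by simp [expInd, hiP]
  have hsub : ∀ j ∈ P, poleModule α I b (P.erase j) ≤ toPolySubmodule (poleSum hd hb F) :=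
    fun j hj => poleModule_le_poleSum hd hb (hlow j hj)
  constructor
  · refine lt_of_le_of_ne ?_ fun heq => ?_
    · rw [poleSum_insert]
      exact le_sup_right
    · have h1 : mon α (-b - expInd P) ∈ toPolySubmodule (poleSum hd hb F) := by
        rw [heq]
        exact poleModule_le_poleSum hd hb (Finset.mem_insert_self P F) hmem
      have h2 : poleSum hd hb F ≤ hQ.toWeyl := iSup₂_le fun S hS => hF S hS
      exact hα.mon_notMem_iSup hPI hP (h2 h1)
  · intro N hN hN'
    obtain ⟨u, huN, huF⟩ := SetLike.exists_of_lt hN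
    have hu := hN'.le huN
    rw [poleSum_insert] at hu
    -- Subtracting the old part `f` leaves an element of `N` in `poleModule α I b P` that is still
    -- outside the lower modules.
    obtain ⟨w, hw, f, hf, rfl⟩ := Submodule.mem_sup.mp hu
    have hwN : w ∈ N := (Submodule.add_mem_iff_left N (hN.le hf)).mp huN
    have hle : poleModule α I b P ≤ toPolySubmodule N := by
      refine (toPolySubmodule_isDStable N).poleModule_le hα hb hnon hPI
        (fun j hj => (hsub j hj).trans (toPolySubmodule_mono hN.le)) hP (u := w) hwN hw
        fun hwL => huF (add_mem ?_ hf)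
      have h3 : ⨆ j : P, poleModule α I b (P.erase j) ≤ toPolySubmodule (poleSum hd hb F) :=
        iSup_le fun j => hsub j j.2
      exact h3 hwL
    refine hN'.not_ge ?_
    rw [poleSum_insert]
    exact sup_le ((poleModule_isDStable α β hd hb P).toWeyl_le_iff.mpr hle) hN.le

include hα hnon in
lemma exists_compositionSeries_poleSum (F : Finset (Finset (Fin m)))
    (hF : ∀ S ∈ F, S ⊆ I ∧ S.card ≤ n) (hlow : ∀ S ∈ F, ∀ T ⊆ S, T ∈ F) :
    ∃ s : CompositionSeries (Submodule (WeylAlgebra n) (TwistedModule α β)),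
      s.head = ⊥ ∧ s.last = poleSum hd hb F ∧ s.length = F.card := by
  classical
  obtain ⟨k, hk⟩ : ∃ k, F.card = k := ⟨_, rfl⟩
  induction k generalizing F with
  | zero =>
    rw [Finset.card_eq_zero] at hk
    subst hk
    exact ⟨RelSeries.singleton _ ⊥, rfl, by simp [poleSum], rfl⟩
  | succ k ih =>
    -- Removing a set of maximal size keeps the family closed under subsets.
    obtain ⟨P, hPF, hPmax⟩ := F.exists_max_image Finset.card
      (Finset.card_pos.mp (by omega))
    have hmax : ∀ S ∈ F.erase P, ¬ P ⊆ S := fun S hS hPS =>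
      Finset.ne_of_mem_erase hS
        (Finset.eq_of_subset_of_card_le hPS (hPmax S (Finset.mem_of_mem_erase hS))).symm
    obtain ⟨s, hs1, hs2, hs3⟩ := ih (F.erase P)
      (fun S hS => hF S (Finset.mem_of_mem_erase hS))
      (fun S hS T hT => Finset.mem_erase.mpr
        ⟨fun h => hmax S hS (h ▸ hT), hlow S (Finset.mem_of_mem_erase hS) T hT⟩)
      (by rw [Finset.card_erase_of_mem hPF, hk, Nat.add_sub_cancel])
    have hcov := poleSum_covBy hα hd hb hnon (hF P hPF).1 (hF P hPF).2 hmax fun j hj =>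
      Finset.mem_erase.mpr
        ⟨(Finset.erase_ssubset hj).ne, hlow P hPF _ (Finset.erase_subset j P)⟩
    rw [Finset.insert_erase hPF, ← hs2] at hcov
    refine ⟨s.snoc _ hcov, ?_, ?_, ?_⟩
    · rw [RelSeries.head_snoc, hs1]
    · rw [RelSeries.last_snoc]
    · rw [RelSeries.snoc_length, hs3, Finset.card_erase_of_mem hPF, hk, Nat.add_sub_cancel]

include hα in
-- `poleModule α I b I` imposes no condition, and sets with more than `n` elements reduce to smaller
-- ones.
lemma poleSum_eq_top : poleSum hd hb (I.powerset.filter fun S => S.card ≤ n) = ⊤ := by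
  have h : ∀ k, ∀ S ⊆ I, S.card = k → poleModule α I b S ≤
      toPolySubmodule (poleSum hd hb (I.powerset.filter fun S => S.card ≤ n)) := by
    intro k
    induction k using Nat.strong_induction_on with
    | _ k ih =>
      intro S hS hk
      by_cases hSn : S.card ≤ n
      · exact poleModule_le_poleSum hd hb (by simp [hS, hSn])
      · refine (hα.poleModule_le_iSup (not_le.mp hSn)).trans (iSup_le fun j => ?_)
        refine ih _ ?_ _ ((Finset.erase_subset _ _).trans hS) rfl
        rw [← hk]
        exact Finset.card_erase_lt_of_mem j.2
  rw [eq_top_iff]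
  intro f _
  obtain ⟨r, c, hf⟩ := exists_eq_smul_mon α ((toTwisted α β).symm f)
  refine h _ I subset_rfl rfl (?_ : (toTwisted α β).symm f ∈ _)
  rw [hf]
  exact smul_mon_mem_poleModule α r fun i hi hi' => absurd hi hi'

lemma card_powerset_filter_card_le {ι : Type*} [DecidableEq ι] (I : Finset ι) (n : ℕ) :
    (I.powerset.filter fun S => S.card ≤ n).card
      = ∑ j ∈ Finset.range (n + 1), I.card.choose j := by
  rw [Finset.card_eq_sum_card_fiberwise (f := Finset.card) (t := Finset.range (n + 1))]
  · refine Finset.sum_congr rfl fun j hj => ?_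
    rw [← Finset.card_powersetCard]
    congr 1
    ext S
    simp only [Finset.mem_filter, Finset.mem_powerset, Finset.mem_powersetCard, Finset.mem_range]
      at hj ⊢
    exact ⟨fun h => ⟨h.1.1, h.2⟩, fun h => ⟨⟨h.1, by omega⟩, h.2⟩⟩
  · intro S hS
    rw [Finset.mem_coe, Finset.mem_filter] at hS
    simpa using Nat.lt_succ_of_le hS.2

end Filtration


end

theorem mainTheorem5 (n m k : ℕ) (hk : k ≤ m)
    (α : Fin m → MvPolynomial (Fin n) ℂ) (hα : InGeneralPosition α)
    (β : Fin m → ℂ)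
    (hβ_int : ∀ i : Fin m, (i : ℕ) < k → ∃ z : ℤ, β i = z)
    (hβ_nonint : ∀ i : Fin m, k ≤ (i : ℕ) → ¬ ∃ z : ℤ, β i = z) :
    Module.length (WeylAlgebra n) (TwistedModule α β)
      = ((∑ j ∈ Finset.range (n + 1), k.choose j : ℕ) : ℕ∞) := by
  classical
  let I : Finset (Fin m) := Finset.univ.filter fun i => (i : ℕ) < k
  have hI : I.card = k := by simp [I, Fin.card_filter_val_lt, hk]
  obtain ⟨b, hb⟩ : ∃ b : Fin m → ℤ, ∀ i ∈ I, β i = b i := by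
    choose b hb using fun i : I => hβ_int i ((Finset.mem_filter.mp i.2).2)
    -- Any integers would do off `I`.
    exact ⟨fun i => if h : i ∈ I then b ⟨i, h⟩ else 0, fun i hi => by simp [hi, hb ⟨i, hi⟩]⟩
  have hnon : ∀ i ∉ I, ¬ ∃ z : ℤ, β i = z := fun i hi => hβ_nonint i (by simpa [I] using hi)
  have hd := fun i => (hα.degree_one i).le
  obtain ⟨s, hs1, hs2, hs3⟩ := exists_compositionSeries_poleSum hα hd hb hnon
    (I.powerset.filter fun S => S.card ≤ n) (fun S hS => by simpa using hS)
    (fun S hS T hT => by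
      rw [Finset.mem_filter, Finset.mem_powerset] at hS ⊢
      exact ⟨hT.trans hS.1, (Finset.card_le_card hT).trans hS.2⟩)
  rw [poleSum_eq_top hα] at hs2
  rw [← Module.length_compositionSeries s hs1 hs2, hs3, card_powerset_filter_card_le, hI]
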